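/- Let $C$ be an algebraically closed field of characteristic zero, let $K=C(x)$ with $D=d/dx$, and let $K[D]$ be the ring of linear differential operators over $K$ (so $Df=fD+f'$ for $f\in K$). Let $L\in K[D]\setminus\{0\}$ have, at every point $\xi\in C\cup\{\infty\}$, a basis of Puiseux series solutions, i.e. $\operatorname{ord}(L)$ many Puiseux series solutions at $\xi$ that are linearly independent over $C$. Let $K[D]/\langle L\rangle$ be the left $K[D]$-module of classes $[P]_L$ modulo $\langle L\rangle=\{PL: P\in K[D]\}$. Definitions. A Puiseux series is integral if it is zero or its starting exponent is nonnegative. $[P]_L$ is integral at $\xi\in C\cup\{\infty\}$ if $P\cdot f$ is integral for every Puiseux series solution $f$ of $L$ at $\xi$; it is (globally) integral if it is integral at every $\xi\in C$, and completely integral if it is integral at every $\xi\in C\cup\{\infty\}$. It is a constant if $D\cdot[P]_L=0$, and a pseudoconstant if it is completely integral but not a constant. An integral basis of $K[D]/\langle L\rangle$ is a basis $w_1,\dots,w_r$ of the $C[x]$-module of globally integral elements. It is normal at infinity, with corresponding integers $\tau_1,\dots,\tau_r\in\mathbb Z$, if $x^{\tau_1}w_1,\dots,x^{\tau_r}w_r$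 is a basis of the module of all elements that are integral at $\infty$, over the ring of rational functions $u/v$ with $\deg u\le\deg v$. Consider the following algorithm with input $L$. (1) Take an integral basis $w_1,\dots,w_r$ of $K[D]/\langle L\rangle$ that is normal at infinity, with corresponding $\tau_1,\dots,\tau_r\in\mathbb Z$. (2) If there are $i\in\{1,\dots,r\}$ and an integer $j$ with $0\le j\le\tau_i$ such that $D\cdot(x^jw_i)\ne0$ in $K[D]/\langle L\rangle$, return such an $x^jw_i$. (3) Otherwise return $\bot$. Theorem. The algorithm is correct: a basis as required in step (1) exists; and whichever such basis and integers $\tau_i$ are taken in step (1), and whichever admissible $x^jw_i$ is chosen in step (2) (a search through finitely many pairs $(i,j)$), the algorithm returns an output, namely a pseudoconstant in $K[D]/\langle L\rangle$ if there is one, and $\bot$ if there is none. -/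

import Mathlib

open Polynomial

noncomputable section

/-! ### The derivation `d/dx` on the field `K = C(x)` of rational functions -/

/-- The derivative of a rational function, by the quotient rule. -/
def ratDerivFun {C : Type*} [Field C] (f : RatFunc C) : RatFunc C :=
  (algebraMap C[X] (RatFunc C) (derivative f.num) * algebraMap C[X] (RatFunc C) f.denom
    - algebraMap C[X] (RatFunc C) f.num * algebraMap C[X] (RatFunc C) (derivative f.denom))
    / algebraMap C[X] (RatFunc C) f.denom ^ 2

theorem ratDerivFun_div {C : Type*} [Field C] (p q : C[X]) (hq : q ≠ 0) :
    ratDerivFun (algebraMap C[X] (RatFunc C) p / algebraMap C[X] (RatFunc C) q) =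
      (algebraMap C[X] (RatFunc C) (derivative p) * algebraMap C[X] (RatFunc C) q
        - algebraMap C[X] (RatFunc C) p * algebraMap C[X] (RatFunc C) (derivative q))
        / algebraMap C[X] (RatFunc C) q ^ 2 := by
  set f := algebraMap C[X] (RatFunc C) p / algebraMap C[X] (RatFunc C) q with hf
  have hd : f.denom ≠ 0 := RatFunc.denom_ne_zero f
  have hd' : algebraMap C[X] (RatFunc C) f.denom ≠ 0 := RatFunc.algebraMap_ne_zero hd
  have hq' : algebraMap C[X] (RatFunc C) q ≠ 0 := RatFunc.algebraMap_ne_zero hq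
  have h1 : p * f.denom = f.num * q := by
    apply RatFunc.algebraMap_injective
    rw [map_mul, map_mul]
    have h0 := RatFunc.num_div_denom f
    rw [hf, div_eq_div_iff hd' hq'] at h0
    rw [← hf] at h0
    exact h0.symm
  have h2 : derivative p * f.denom + p * derivative f.denom
      = derivative f.num * q + f.num * derivative q := by
    rw [← derivative_mul, ← derivative_mul, h1]
  have h1' := congrArg (algebraMap C[X] (RatFunc C)) h1
  have h2' := congrArg (algebraMap C[X] (RatFunc C)) h2
  simp only [map_mul, map_add] at h1' h2'
  unfold ratDerivFun
  rw [div_eq_div_iff (pow_ne_zero 2 hd') (pow_ne_zero 2 hq')]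
  linear_combination
    (-(algebraMap C[X] (RatFunc C) q * algebraMap C[X] (RatFunc C) f.denom)) * h2'
    + (algebraMap C[X] (RatFunc C) (derivative q) * algebraMap C[X] (RatFunc C) f.denom
      + algebraMap C[X] (RatFunc C) (derivative f.denom) * algebraMap C[X] (RatFunc C) q) * h1'

/-- The usual derivation `d/dx` on `C(x)`. -/
def ratDeriv (C : Type*) [Field C] : Derivation C (RatFunc C) (RatFunc C) :=
  Derivation.mk'
    { toFun := ratDerivFun
      map_add' := fun f g => by
        induction f using RatFunc.induction_on with
        | _ p q hq =>
        induction g using RatFunc.induction_on with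
        | _ r s hs =>
        have hq' : algebraMap C[X] (RatFunc C) q ≠ 0 := RatFunc.algebraMap_ne_zero hq
        have hs' : algebraMap C[X] (RatFunc C) s ≠ 0 := RatFunc.algebraMap_ne_zero hs
        have h : algebraMap C[X] (RatFunc C) p / algebraMap C[X] (RatFunc C) q
            + algebraMap C[X] (RatFunc C) r / algebraMap C[X] (RatFunc C) s
            = algebraMap C[X] (RatFunc C) (p * s + q * r)
              / algebraMap C[X] (RatFunc C) (q * s) := by
          rw [div_add_div _ _ hq' hs']; simp
        rw [h, ratDerivFun_div _ _ (mul_ne_zero hq hs), ratDerivFun_div _ _ hq,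
          ratDerivFun_div _ _ hs]
        simp only [derivative_mul, map_mul, map_add]
        field_simp
        ring
      map_smul' := fun c f => by
        induction f using RatFunc.induction_on with
        | _ p q hq =>
        have h : c • (algebraMap C[X] (RatFunc C) p / algebraMap C[X] (RatFunc C) q)
            = algebraMap C[X] (RatFunc C) (c • p) / algebraMap C[X] (RatFunc C) q := by
          rw [div_eq_mul_inv, div_eq_mul_inv, ← smul_mul_assoc]
          congr 1
          rw [Algebra.smul_def, Algebra.smul_def, map_mul, ← IsScalarTower.algebraMap_apply]
        rw [h, ratDerivFun_div _ _ hq, ratDerivFun_div _ _ hq, derivative_smul]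
        simp only [Algebra.smul_def, map_mul, ← IsScalarTower.algebraMap_apply, RingHom.id_apply]
        ring }
    (fun f g => by
      change ratDerivFun (f * g) = f • ratDerivFun g + g • ratDerivFun f
      induction f using RatFunc.induction_on with
      | _ p q hq =>
      induction g using RatFunc.induction_on with
      | _ r s hs =>
      have hq' : algebraMap C[X] (RatFunc C) q ≠ 0 := RatFunc.algebraMap_ne_zero hq
      have hs' : algebraMap C[X] (RatFunc C) s ≠ 0 := RatFunc.algebraMap_ne_zero hs
      have h : algebraMap C[X] (RatFunc C) p / algebraMap C[X] (RatFunc C) q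
          * (algebraMap C[X] (RatFunc C) r / algebraMap C[X] (RatFunc C) s)
          = algebraMap C[X] (RatFunc C) (p * r) / algebraMap C[X] (RatFunc C) (q * s) := by
        rw [div_mul_div_comm]; simp
      rw [h, ratDerivFun_div _ _ (mul_ne_zero hq hs), ratDerivFun_div _ _ hq,
        ratDerivFun_div _ _ hs]
      simp only [derivative_mul, map_mul, map_add, smul_eq_mul]
      field_simp
      ring)

/-! ### The ring `K[D]` of linear differential operators -/

/-- Linear differential operators `p₀ + p₁ D + ⋯ + pᵣ Dʳ` with coefficients in `C(x)`.
The underlying additive group is that of polynomials in `D` with coefficients written on the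
left; the multiplication is *not* the one of polynomials, see `DiffOp.instRing`. -/
def DiffOp (C : Type*) [Field C] : Type _ := (RatFunc C)[X]

namespace DiffOp

variable {C : Type*} [Field C]

instance : AddCommGroup (DiffOp C) := inferInstanceAs (AddCommGroup (RatFunc C)[X])
instance : Module (RatFunc C) (DiffOp C) := inferInstanceAs (Module (RatFunc C) (RatFunc C)[X])
instance : Module C[X] (DiffOp C) := inferInstanceAs (Module C[X] (RatFunc C)[X])

/-- The list of coefficients of an operator, as a polynomial in a commuting variable. -/
def toPoly (P : DiffOp C) : (RatFunc C)[X] := P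

/-- The operator `a Dⁱ`. -/
def mono (i : ℕ) (a : RatFunc C) : DiffOp C := monomial i a

/-- The order of an operator (`0` for the zero operator). -/
def order (P : DiffOp C) : ℕ := P.toPoly.natDegree

/-- Multiplication by `D` from the left: `D · (a Dⁱ) = a' Dⁱ + a Dⁱ⁺¹`. -/
def leftD : DiffOp C →+ DiffOp C where
  toFun P := P.toPoly.sum fun i a => mono i (ratDeriv C a) + mono (i + 1) a
  map_zero' := sum_zero_index fun (i : ℕ) (a : RatFunc C) =>
    (mono i (ratDeriv C a) + mono (i + 1) a : DiffOp C)
  map_add' P Q := by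
    refine sum_add_index (S := DiffOp C) P Q
      (fun i a => mono i (ratDeriv C a) + mono (i + 1) a) ?_ ?_
    · intro i
      rw [Derivation.map_zero]
      change (monomial i (0 : RatFunc C) + monomial (i + 1) (0 : RatFunc C) : (RatFunc C)[X]) = 0
      simp
    · intro i a b
      rw [Derivation.map_add]
      change (monomial i (_ + _) + monomial (i + 1) (a + b) : (RatFunc C)[X])
        = (monomial i _ + monomial (i + 1) a) + (monomial i _ + monomial (i + 1) b)
      rw [map_add, map_add]
      abel

theorem leftD_mono (i : ℕ) (a : RatFunc C) :
    leftD (mono i a) = mono i (ratDeriv C a) + mono (i + 1) a := by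
  refine sum_monomial_index (S := DiffOp C) a
    (fun i a => mono i (ratDeriv C a) + mono (i + 1) a) ?_
  rw [Derivation.map_zero]
  change (monomial i (0 : RatFunc C) + monomial (i + 1) (0 : RatFunc C) : (RatFunc C)[X]) = 0
  simp

theorem smul_mono (a b : RatFunc C) (i : ℕ) : a • mono i b = mono i (a * b) :=
  smul_monomial a i b

theorem mono_add (a b : RatFunc C) (i : ℕ) : mono i (a + b) = mono i a + mono i b :=
  map_add (monomial i) a b

theorem induction_add {motive : DiffOp C → Prop}
    (add : ∀ P Q, motive P → motive Q → motive (P + Q))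
    (mono : ∀ i a, motive (mono i a)) (P : DiffOp C) : motive P :=
  Polynomial.induction_on' (motive := motive) P add mono

/-- The Leibniz rule. -/
theorem leftD_smul (a : RatFunc C) (P : DiffOp C) :
    leftD (a • P) = ratDeriv C a • P + a • leftD P := by
  induction P using induction_add with
  | add P Q hP hQ => rw [smul_add, map_add, hP, hQ, map_add, smul_add, smul_add]; abel
  | mono i b =>
    rw [smul_mono, leftD_mono, leftD_mono, smul_add, smul_mono, smul_mono, smul_mono,
      Derivation.leibniz, mono_add, smul_eq_mul, smul_eq_mul, mul_comm b]
    abel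

/-- Composition of operators: `(∑ aᵢ Dⁱ) · Q = ∑ aᵢ (Dⁱ · Q)`. -/
def mulHom : DiffOp C →+ (DiffOp C →+ DiffOp C) where
  toFun P :=
    { toFun := fun Q => P.toPoly.sum fun i a => a • (leftD^[i] Q)
      map_zero' := by simp [Polynomial.sum, iterate_map_zero]
      map_add' := fun Q R => by
        simp only [Polynomial.sum, iterate_map_add, smul_add, Finset.sum_add_distrib] }
  map_zero' := by
    ext Q
    exact sum_zero_index (fun (i : ℕ) (a : RatFunc C) => a • (leftD^[i] Q))
  map_add' P Q := by
    ext R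
    exact sum_add_index (S := DiffOp C) P Q (fun i a => a • (leftD^[i] R))
      (fun i => zero_smul (RatFunc C) (leftD^[i] R)) (fun i a b => add_smul a b (leftD^[i] R))

theorem mulHom_mono (i : ℕ) (a : RatFunc C) (Q : DiffOp C) :
    mulHom (mono i a) Q = a • (leftD^[i] Q) :=
  sum_monomial_index (S := DiffOp C) a (fun i a => a • (leftD^[i] Q))
    (zero_smul (RatFunc C) (leftD^[i] Q))

theorem mulHom_leftD (P Q : DiffOp C) : mulHom (leftD P) Q = leftD (mulHom P Q) := by
  induction P using induction_add with
  | add P R hP hR => simp only [map_add, AddMonoidHom.add_apply, hP, hR]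
  | mono i a =>
    rw [leftD_mono, map_add, AddMonoidHom.add_apply, mulHom_mono, mulHom_mono, mulHom_mono,
      leftD_smul, Function.iterate_succ_apply']

theorem mulHom_leftD_iterate (i : ℕ) (P Q : DiffOp C) :
    mulHom (leftD^[i] P) Q = leftD^[i] (mulHom P Q) := by
  induction i with
  | zero => rfl
  | succ i ih => rw [Function.iterate_succ_apply', mulHom_leftD, ih, Function.iterate_succ_apply']

theorem mulHom_smul (a : RatFunc C) (P Q : DiffOp C) :
    mulHom (a • P) Q = a • mulHom P Q := by
  induction P using induction_add with
  | add P R hP hR => simp only [map_add, smul_add, AddMonoidHom.add_apply, hP, hR]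
  | mono i b => rw [smul_mono, mulHom_mono, mulHom_mono, mul_smul]

theorem leftD_iterate_one (i : ℕ) : leftD^[i] (mono 0 (1 : RatFunc C)) = mono i 1 := by
  induction i with
  | zero => rfl
  | succ i ih =>
    have h : (mono i (0 : RatFunc C) : DiffOp C) = 0 := map_zero (monomial i)
    rw [Function.iterate_succ_apply', ih, leftD_mono, Derivation.map_one_eq_zero, h, zero_add]

/-- The ring structure on `K[D]`: the product is the composition of operators, so that
`D a = a D + a'` for `a ∈ K`. -/
instance instRing : Ring (DiffOp C) where
  __ := instAddCommGroup
  mul P Q := mulHom P Q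
  one := mono 0 1
  left_distrib P Q R := map_add (mulHom P) Q R
  right_distrib P Q R := by
    change mulHom (P + Q) R = mulHom P R + mulHom Q R
    rw [map_add, AddMonoidHom.add_apply]
  zero_mul P := by
    change mulHom 0 P = 0
    rw [map_zero, AddMonoidHom.zero_apply]
  mul_zero P := map_zero (mulHom P)
  mul_assoc P Q R := by
    change mulHom (mulHom P Q) R = mulHom P (mulHom Q R)
    induction P using induction_add with
    | add P S hP hS => simp only [map_add, AddMonoidHom.add_apply, hP, hS]
    | mono i a => rw [mulHom_mono, mulHom_mono, mulHom_smul, mulHom_leftD_iterate]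
  one_mul P := by
    change mulHom (mono 0 1) P = P
    rw [mulHom_mono, one_smul]; rfl
  mul_one P := by
    change mulHom P (mono 0 1) = P
    induction P using induction_add with
    | add P S hP hS => simp only [map_add, AddMonoidHom.add_apply, hP, hS]
    | mono i a => rw [mulHom_mono, leftD_iterate_one, smul_mono, mul_one]

instance : IsScalarTower (RatFunc C) (DiffOp C) (DiffOp C) :=
  ⟨fun a P Q => mulHom_smul a P Q⟩

instance : IsScalarTower C[X] (RatFunc C) (DiffOp C) :=
  inferInstanceAs (IsScalarTower C[X] (RatFunc C) (RatFunc C)[X])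

instance : IsScalarTower C[X] (DiffOp C) (DiffOp C) :=
  ⟨fun a P Q => by
    rw [← algebraMap_smul (RatFunc C) a P, ← algebraMap_smul (RatFunc C) a (P • Q),
      smul_assoc]⟩

/-- The operator `D`. -/
def D : DiffOp C := mono 1 1

/-- The left `K[D]`-module `K[D]/⟨L⟩`, where `⟨L⟩ = {P · L | P ∈ K[D]}`. It is also a module
over `K = C(x)` and over `C[x]`, acting by multiplication from the left. -/
abbrev Quot (L : DiffOp C) : Type _ := DiffOp C ⧸ Submodule.span (DiffOp C) {L}

/-- The class `[P]_L` of an operator `P`. -/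
def cls (L P : DiffOp C) : Quot L := Submodule.Quotient.mk P

end DiffOp

/-! ### Puiseux series at the points of `C ∪ {∞}`

A Puiseux series at `ξ` is a series in the local parameter `t`, with `t = x - ξ` for `ξ ∈ C` and
`t = 1/x` for `ξ = ∞`, with rational exponents that have a common denominator. The ambient field
is the one of Hahn series in `t` with exponents in `ℚ`. -/

section Puiseux

variable {C : Type*} [Field C]

/-- The exponents of `f` have a common denominator. -/
def IsPuiseux (f : HahnSeries ℚ C) : Prop :=
  ∃ q : ℕ, 0 < q ∧ ∀ e ∈ f.support, ∃ n : ℤ, e = (n : ℚ) / (q : ℚ)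

/-- The starting exponent of `f` is nonnegative (or `f = 0`). -/
def IsIntegralSeries (f : HahnSeries ℚ C) : Prop := 0 ≤ f.orderTop

/-- The operator `t · d/dt`. -/
def eulerOp (f : HahnSeries ℚ C) : HahnSeries ℚ C where
  coeff e := (e : C) * f.coeff e
  isPWO_support' := f.isPWO_support.mono fun e he => by
    intro h
    exact he (by simp [h])

/-- The derivation `d/dx` on series at `ξ`: it is `d/dt = t⁻¹ · (t · d/dt)` at a finite point, and
`-t² · d/dt = -t · (t · d/dt)` at infinity. -/
def derivAt (ξ : OnePoint C) (f : HahnSeries ℚ C) : HahnSeries ℚ C :=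
  ξ.elim (HahnSeries.single 1 (-1) * eulerOp f) fun _ => HahnSeries.single (-1) 1 * eulerOp f

/-- The expansion of `x` at `ξ`: it is `ξ + t` at a finite point, and `t⁻¹` at infinity. -/
def xAt (ξ : OnePoint C) : HahnSeries ℚ C :=
  ξ.elim (HahnSeries.single (-1) 1) fun c => HahnSeries.C c + HahnSeries.single 1 1

theorem coeff_eval₂_single {e : ℚ} (he : e ≠ 0) (p : C[X]) (n : ℕ) :
    (p.eval₂ HahnSeries.C (HahnSeries.single e (1 : C))).coeff (n * e) = p.coeff n := by
  induction p using Polynomial.induction_on' with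
  | add p q hp hq => simp [hp, hq, eval₂_add]
  | monomial m a =>
    rw [eval₂_monomial, HahnSeries.single_pow, one_pow, HahnSeries.C_apply,
      HahnSeries.single_mul_single, zero_add, mul_one, nsmul_eq_mul, coeff_monomial]
    by_cases h : m = n
    · simp [h]
    · rw [if_neg h, HahnSeries.coeff_single_of_ne]
      intro h'
      exact h (by exact_mod_cast (mul_right_cancel₀ he h').symm)

theorem eval₂_xAt_ne_zero (ξ : OnePoint C) (p : C[X]) (hp : p ≠ 0) :
    p.eval₂ HahnSeries.C (xAt ξ) ≠ 0 := by
  have key : ∀ {e : ℚ}, e ≠ 0 → ∀ q : C[X], q ≠ 0 →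
      q.eval₂ HahnSeries.C (HahnSeries.single e (1 : C)) ≠ 0 := by
    intro e he q hq h
    apply hq
    ext n
    rw [← coeff_eval₂_single he, h]
    simp
  induction ξ using OnePoint.rec with
  | infty => exact key (by norm_num) p hp
  | coe c =>
    have h : p.eval₂ HahnSeries.C (xAt (c : OnePoint C))
        = (p.comp (X + Polynomial.C c)).eval₂ HahnSeries.C
          (HahnSeries.single (1 : ℚ) (1 : C)) := by
      rw [eval₂_comp, eval₂_add, eval₂_X, eval₂_C, add_comm]
      rfl
    rw [h]
    refine key (by norm_num) _ ?_
    intro h0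
    rcases comp_eq_zero_iff.1 h0 with h1 | ⟨_, h1⟩
    · exact hp h1
    · have h2 := congrArg (fun q => q.coeff 1) h1
      simp [coeff_X, coeff_C] at h2

theorem nonZeroDivisors_le_comap_xAt (ξ : OnePoint C) :
    nonZeroDivisors C[X] ≤
      (nonZeroDivisors (HahnSeries ℚ C)).comap (eval₂RingHom HahnSeries.C (xAt ξ)) :=
  fun p hp => mem_nonZeroDivisors_of_ne_zero (eval₂_xAt_ne_zero ξ p (nonZeroDivisors.ne_zero hp))

/-- The expansion of rational functions at `ξ`. -/
def expandAt (ξ : OnePoint C) : RatFunc C →+* HahnSeries ℚ C :=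
  RatFunc.liftRingHom (eval₂RingHom HahnSeries.C (xAt ξ)) (nonZeroDivisors_le_comap_xAt ξ)

namespace DiffOp

/-- The action of operators on series at `ξ`: `(∑ aᵢ Dⁱ) · f = ∑ aᵢ f⁽ⁱ⁾`. -/
def actAt (ξ : OnePoint C) (P : DiffOp C) (f : HahnSeries ℚ C) : HahnSeries ℚ C :=
  P.toPoly.sum fun i a => expandAt ξ a * (derivAt ξ)^[i] f

/-- `f` is a Puiseux series solution of `L` at `ξ`. -/
def IsPuiseuxSolution (L : DiffOp C) (ξ : OnePoint C) (f : HahnSeries ℚ C) : Prop :=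
  IsPuiseux f ∧ actAt ξ L f = 0

/-- At every point of `C ∪ {∞}`, the operator `L` has a basis of Puiseux series solutions, i.e.
`ord L` many that are linearly independent over `C`. -/
def HasPuiseuxBases (L : DiffOp C) : Prop :=
  ∀ ξ : OnePoint C, ∃ f : Fin L.order → HahnSeries ℚ C,
    LinearIndependent C f ∧ ∀ i, L.IsPuiseuxSolution ξ (f i)

/-! ### Integrality and pseudoconstants -/

/-- `m = [P]_L` is integral at `ξ`: for every Puiseux series solution `f` of `L` at `ξ` the series
`P · f` is integral. (This does not depend on the representative `P`.) -/
def IsIntegralAt {L : DiffOp C} (ξ : OnePoint C) (m : L.Quot) : Prop :=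
  ∀ P : DiffOp C, L.cls P = m → ∀ f, L.IsPuiseuxSolution ξ f → IsIntegralSeries (actAt ξ P f)

/-- Integral at every point of `C` (but not necessarily at infinity). -/
def IsGloballyIntegral {L : DiffOp C} (m : L.Quot) : Prop :=
  ∀ ξ : C, IsIntegralAt (ξ : OnePoint C) m

/-- Integral at every point of `C ∪ {∞}`. -/
def IsCompletelyIntegral {L : DiffOp C} (m : L.Quot) : Prop :=
  ∀ ξ : OnePoint C, IsIntegralAt ξ m

/-- `m` is a constant: `D · m = 0`. -/
def IsConstant {L : DiffOp C} (m : L.Quot) : Prop := (D : DiffOp C) • m = 0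

/-- `m` is completely integral, but not a constant. -/
def IsPseudoconstant {L : DiffOp C} (m : L.Quot) : Prop :=
  IsCompletelyIntegral m ∧ ¬ IsConstant m

/-- `w` is a basis of the `C[x]`-module of all globally integral elements. -/
def IsIntegralBasis {L : DiffOp C} {r : ℕ} (w : Fin r → L.Quot) : Prop :=
  LinearIndependent C[X] w ∧
    ∀ m : L.Quot, m ∈ Submodule.span C[X] (Set.range w) ↔ IsGloballyIntegral m

/-- The ring `C(x)_∞` of all rational functions `u/v` with `deg u ≤ deg v`. -/
def ratAtInfinity (C : Type*) [Field C] : Subring (RatFunc C) where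
  carrier := {f | ∃ u v : C[X], v ≠ 0 ∧ u.degree ≤ v.degree ∧
    f = algebraMap C[X] (RatFunc C) u / algebraMap C[X] (RatFunc C) v}
  one_mem' := ⟨1, 1, one_ne_zero, le_rfl, by simp⟩
  zero_mem' := ⟨0, 1, one_ne_zero, by simp, by simp⟩
  neg_mem' := by
    rintro _ ⟨u, v, hv, h, rfl⟩
    exact ⟨-u, v, hv, by rwa [degree_neg], by rw [map_neg, neg_div]⟩
  mul_mem' := by
    rintro _ _ ⟨u, v, hv, h, rfl⟩ ⟨u', v', hv', h', rfl⟩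
    refine ⟨u * u', v * v', mul_ne_zero hv hv', ?_, ?_⟩
    · rw [degree_mul, degree_mul]
      exact add_le_add h h'
    · rw [map_mul, map_mul, div_mul_div_comm]
  add_mem' := by
    rintro _ _ ⟨u, v, hv, h, rfl⟩ ⟨u', v', hv', h', rfl⟩
    refine ⟨u * v' + v * u', v * v', mul_ne_zero hv hv', ?_, ?_⟩
    · refine (degree_add_le _ _).trans (max_le ?_ ?_)
      · rw [degree_mul, degree_mul]
        exact add_le_add h le_rfl
      · rw [degree_mul, degree_mul]
        exact add_le_add le_rfl h'
    · rw [div_add_div _ _ (RatFunc.algebraMap_ne_zero hv) (RatFunc.algebraMap_ne_zero hv')]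
      simp only [map_add, map_mul]

/-- `v` is a basis of the `C(x)_∞`-module of all elements that are integral at infinity. -/
def IsLocalBasisAtInfinity {L : DiffOp C} {r : ℕ} (v : Fin r → L.Quot) : Prop :=
  LinearIndependent (ratAtInfinity C) v ∧
    ∀ m : L.Quot, m ∈ Submodule.span (ratAtInfinity C) (Set.range v) ↔
      IsIntegralAt (OnePoint.infty : OnePoint C) m

/-! ### The algorithm -/

/-- The outcome of the first step: an integral basis `w₁, …, wᵣ` of `K[D]/⟨L⟩` that is normal at
infinity, with the corresponding integers `τ₁, …, τᵣ`, so that `x^τ₁ w₁, …, x^τᵣ wᵣ` is a local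
integral basis at infinity. -/
structure NormalIntegralBasis (L : DiffOp C) where
  r : ℕ
  w : Fin r → L.Quot
  τ : Fin r → ℤ
  isIntegralBasis : IsIntegralBasis w
  normal : IsLocalBasisAtInfinity fun i => (RatFunc.X : RatFunc C) ^ τ i • w i

namespace NormalIntegralBasis

/-- The element `x^j w_i`. -/
def elt {L : DiffOp C} (B : NormalIntegralBasis L) (i : Fin B.r) (j : ℕ) : L.Quot :=
  (RatFunc.X : RatFunc C) ^ j • B.w i

/-- The finite set of pairs `(i, j)` with `0 ≤ j ≤ τ_i` through which the second step runs. It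
contains no pair `(i, j)` when `τ_i < 0`. -/
def pairs {L : DiffOp C} (B : NormalIntegralBasis L) : Finset ((_ : Fin B.r) × ℕ) :=
  Finset.univ.sigma fun i => Finset.range (B.τ i + 1).toNat

/-- `B.Returns out`: after the first step has produced `B`, the algorithm may return `out`, where
`none` stands for `⊥`. The second step returns some `x^j w_i` with `0 ≤ j ≤ τ_i` and
`D · x^j w_i ≠ 0`, if there is one (which one is left open); otherwise the third step
returns `⊥`. -/
inductive Returns {L : DiffOp C} (B : NormalIntegralBasis L) : Option L.Quot → Prop
  | found (p : (_ : Fin B.r) × ℕ) (hp : p ∈ B.pairs) (hne : (D : DiffOp C) • B.elt p.1 p.2 ≠ 0) :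
      Returns B (some (B.elt p.1 p.2))
  | bot (h : ∀ p ∈ B.pairs, (D : DiffOp C) • B.elt p.1 p.2 = 0) : Returns B none

end NormalIntegralBasis

end DiffOp

end Puiseux

end

/-! Write V = K[D]/⟨L⟩. The globally integral elements form a C[x]-lattice M in V, the elements
integral at infinity a lattice N over C(x)_∞, and the completely integral elements are M ∩ N.
Suppose w is a basis of M and the x^τ_i w_i form a basis of N. Expanding m ∈ M ∩ N in both bases
gives polynomials p_i and functions b_i without pole at infinity with p_i = b_i x^τ_i, hence deg p_i
≤ τ_i or p_i = 0. So M ∩ N is spanned over C by the x^j w_i with 0 ≤ j ≤ τ_i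
(`exists_eq_sum_of_isCompletelyIntegral`). Since D is C-linear on V, either one of these generators
is a pseudoconstant or no pseudoconstant exists (`isConstant_of_forall_pairs`).

The harder half is the existence of a normal basis. To see that M is a lattice, denominators have to
be bounded. At each point the Wronskian matrix of a basis of solutions is invertible, which bounds
the poles of the coefficients of integral classes (`exists_localParam_pow_mul_coeff_mem`). At all
but finitely many points there are solutions with arbitrary initial values, so the coefficients have
no poles there at all (`isIntegralAt_ofCoeffs_iff`). Hence M lies between two finitely generated
C[x]-modules of full rank and is free of rank dim V.

The basis is then made normal by lattice reduction: among all bases w of M and exponents with x^τ_i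
w_i ∈ N, take one with maximal ∑ τ_i. A dependence of the x^τ_i w_i modulo x⁻¹N would allow an
exponent to be raised (`exists_exchange`), so they are independent modulo x⁻¹N, and this forces them
to generate N (`mem_ratAtInfinity_of_sum_smul_mem`). -/

noncomputable section

/-! ### Differential calculus of series at a point -/

section Series

variable {C : Type*} [Field C]

theorem coeff_eulerOp (f : HahnSeries ℚ C) (e : ℚ) : (eulerOp f).coeff e = (e : C) * f.coeff e :=
  rfl

theorem derivAt_infty (f : HahnSeries ℚ C) :
    derivAt (OnePoint.infty : OnePoint C) f = HahnSeries.single 1 (-1) * eulerOp f := rfl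

theorem derivAt_coe (c : C) (f : HahnSeries ℚ C) :
    derivAt (c : OnePoint C) f = HahnSeries.single (-1) 1 * eulerOp f := rfl

theorem xAt_infty : xAt (OnePoint.infty : OnePoint C) = HahnSeries.single (-1) 1 := rfl

theorem xAt_coe (c : C) :
    xAt (c : OnePoint C) = HahnSeries.C c + HahnSeries.single 1 1 := rfl

/-- Finite points and infinity differ only by the factor u, so the properties of the derivation can
be checked on the Euler operator. -/
theorem exists_derivAt_eq_mul_eulerOp (ξ : OnePoint C) :
    ∃ u : HahnSeries ℚ C, u ≠ 0 ∧ ∀ f, derivAt ξ f = u * eulerOp f := by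
  induction ξ using OnePoint.rec with
  | infty => exact ⟨_, HahnSeries.single_ne_zero (neg_ne_zero.2 one_ne_zero), derivAt_infty⟩
  | coe c => exact ⟨_, HahnSeries.single_ne_zero one_ne_zero, derivAt_coe c⟩

theorem eulerOp_add (f g : HahnSeries ℚ C) : eulerOp (f + g) = eulerOp f + eulerOp g := by
  ext e
  simp [coeff_eulerOp, mul_add]

theorem eulerOp_smul (a : C) (f : HahnSeries ℚ C) : eulerOp (a • f) = a • eulerOp f := by
  ext e
  simp [coeff_eulerOp, mul_left_comm]

/-- Exponents add when monomials are multiplied. Characteristic zero makes the cast from ℚ to C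
additive. -/
theorem eulerOp_mul [CharZero C] (f g : HahnSeries ℚ C) :
    eulerOp (f * g) = f * eulerOp g + g * eulerOp f := by
  have hs : ∀ f : HahnSeries ℚ C, (eulerOp f).support ⊆ f.support := fun f e he h =>
    he (by rw [coeff_eulerOp, h, mul_zero])
  ext e
  -- The Euler operator can only shrink supports, so all three products are summed over the
  -- antidiagonal of the supports of f and g and compared termwise.
  rw [mul_comm g, HahnSeries.coeff_add, HahnSeries.coeff_mul_right' g.isPWO_support (hs g),
    HahnSeries.coeff_mul_left' f.isPWO_support (hs f), ← Finset.sum_add_distrib,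
    coeff_eulerOp, HahnSeries.coeff_mul, Finset.mul_sum]
  refine Finset.sum_congr rfl fun p hp => ?_
  rw [coeff_eulerOp, coeff_eulerOp, ← (Finset.mem_antidiagonal.1 hp).2.2]
  push_cast
  ring

/-- The derivation `d/dx` on series at `ξ`, as a linear map. -/
def derivLin (ξ : OnePoint C) : HahnSeries ℚ C →ₗ[C] HahnSeries ℚ C where
  toFun := derivAt ξ
  map_add' f g := by
    obtain ⟨u, -, hu⟩ := exists_derivAt_eq_mul_eulerOp ξ
    rw [hu, hu, hu, eulerOp_add, mul_add]
  map_smul' a f := by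
    obtain ⟨u, -, hu⟩ := exists_derivAt_eq_mul_eulerOp ξ
    rw [hu, hu, eulerOp_smul, RingHom.id_apply, ← HahnSeries.C_mul_eq_smul,
      ← HahnSeries.C_mul_eq_smul, mul_left_comm]

theorem derivLin_apply (ξ : OnePoint C) (f : HahnSeries ℚ C) : derivLin ξ f = derivAt ξ f := rfl

theorem derivAt_xAt (ξ : OnePoint C) : derivAt ξ (xAt ξ) = 1 := by
  have h : ∀ (e : ℚ) (a : C), eulerOp (HahnSeries.single e a) = HahnSeries.single e (e * a) := by
    intro e a
    ext e'
    rw [coeff_eulerOp, HahnSeries.coeff_single, HahnSeries.coeff_single]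
    split_ifs with he
    · rw [he]
    · rw [mul_zero]
  induction ξ using OnePoint.rec with
  | infty =>
    rw [derivAt_infty, xAt_infty, h, HahnSeries.single_mul_single]
    simp
  | coe c =>
    rw [derivAt_coe, xAt_coe, eulerOp_add, HahnSeries.C_apply, h, h]
    simp [HahnSeries.single_mul_single]

theorem expandAt_algebraMap (ξ : OnePoint C) (p : C[X]) :
    expandAt ξ (algebraMap C[X] (RatFunc C) p) = p.eval₂ HahnSeries.C (xAt ξ) :=
  RatFunc.liftRingHom_algebraMap _ _ p

theorem expandAt_X (ξ : OnePoint C) : expandAt ξ RatFunc.X = xAt ξ := by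
  rw [← RatFunc.algebraMap_X, expandAt_algebraMap, eval₂_X]

variable [CharZero C]

theorem derivAt_mul (ξ : OnePoint C) (f g : HahnSeries ℚ C) :
    derivAt ξ (f * g) = f * derivAt ξ g + g * derivAt ξ f := by
  obtain ⟨u, -, hu⟩ := exists_derivAt_eq_mul_eulerOp ξ
  rw [hu, hu, hu, eulerOp_mul]
  ring

theorem eq_C_of_derivAt_eq_zero {ξ : OnePoint C} {f : HahnSeries ℚ C} (h : derivAt ξ f = 0) :
    f = HahnSeries.C (f.coeff 0) := by
  obtain ⟨u, hu0, hu⟩ := exists_derivAt_eq_mul_eulerOp ξ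
  rw [hu] at h
  have h' := (mul_eq_zero.1 h).resolve_left hu0
  ext e
  rw [HahnSeries.C_apply, HahnSeries.coeff_single]
  split_ifs with he
  · rw [he]
  · have h1 := congrArg (fun g => g.coeff e) h'
    simp only [coeff_eulerOp, HahnSeries.coeff_zero, mul_eq_zero, Rat.cast_eq_zero] at h1
    exact h1.resolve_left he

theorem derivAt_eval₂ (ξ : OnePoint C) (p : C[X]) :
    derivAt ξ (p.eval₂ HahnSeries.C (xAt ξ)) = (derivative p).eval₂ HahnSeries.C (xAt ξ) := by
  induction p using Polynomial.induction_on with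
  | C a =>
    have h := map_smul (derivLin ξ) a 1
    -- The Leibniz rule for 1 · 1 shows that 1, and with it every constant, has derivative zero.
    have h1 := derivAt_mul ξ (1 : HahnSeries ℚ C) 1
    rw [mul_one, one_mul, left_eq_add] at h1
    rwa [derivLin_apply, derivLin_apply, h1, smul_zero, ← HahnSeries.C_mul_eq_smul, mul_one,
      ← eval₂_C HahnSeries.C (xAt ξ), ← eval₂_zero HahnSeries.C (xAt ξ), ← derivative_C (a := a)]
      at h
  | add p q hp hq =>
    rw [eval₂_add, map_add, eval₂_add, ← hp, ← hq]
    exact map_add (derivLin ξ) _ _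
  | monomial n a h =>
    rw [pow_succ, ← mul_assoc, eval₂_mul, derivAt_mul, h, eval₂_X, derivAt_xAt,
      derivative_mul (g := X), derivative_X, eval₂_add, eval₂_mul, eval₂_mul, eval₂_mul, eval₂_mul,
      eval₂_one, eval₂_X]
    ring

/-- Apply the Leibniz rule to (p/q) · q = p and solve for the derivative of p/q. This compatibility
turns series into a left K[D]-module. -/
theorem expandAt_ratDeriv (ξ : OnePoint C) (a : RatFunc C) :
    expandAt ξ (ratDeriv C a) = derivAt ξ (expandAt ξ a) := by
  induction a using RatFunc.induction_on with
  | _ p q hq =>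
  have hq' := eval₂_xAt_ne_zero ξ q hq
  have h := derivAt_mul ξ (p.eval₂ HahnSeries.C (xAt ξ) / q.eval₂ HahnSeries.C (xAt ξ))
    (q.eval₂ HahnSeries.C (xAt ξ))
  change expandAt ξ (ratDerivFun _) = _
  rw [ratDerivFun_div p q hq]
  rw [div_mul_cancel₀ _ hq', derivAt_eval₂, derivAt_eval₂] at h
  simp only [map_div₀, map_mul, map_sub, map_pow, expandAt_algebraMap]
  rw [h]
  field_simp
  ring

end Series

namespace DiffOp

variable {C : Type*} [Field C]

/-! ### The action of operators on series -/

theorem actAt_mono (ξ : OnePoint C) (i : ℕ) (a : RatFunc C) (f : HahnSeries ℚ C) :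
    actAt ξ (mono i a) f = expandAt ξ a * (derivAt ξ)^[i] f :=
  sum_monomial_index (S := HahnSeries ℚ C) a _ (by rw [map_zero, zero_mul])

theorem actAt_add (ξ : OnePoint C) (P Q : DiffOp C) (f : HahnSeries ℚ C) :
    actAt ξ (P + Q) f = actAt ξ P f + actAt ξ Q f :=
  sum_add_index (S := HahnSeries ℚ C) P Q _ (fun i => by rw [map_zero, zero_mul])
    (fun i a b => by rw [map_add, add_mul])

theorem actAt_zero (ξ : OnePoint C) (f : HahnSeries ℚ C) : actAt ξ 0 f = 0 :=
  sum_zero_index (S := HahnSeries ℚ C) _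

theorem actAt_smul (ξ : OnePoint C) (a : RatFunc C) (P : DiffOp C) (f : HahnSeries ℚ C) :
    actAt ξ (a • P) f = expandAt ξ a * actAt ξ P f := by
  induction P using induction_add with
  | add P Q hP hQ => rw [smul_add, actAt_add, actAt_add, hP, hQ, mul_add]
  | mono i b => rw [smul_mono, actAt_mono, actAt_mono, map_mul, mul_assoc]

theorem iterate_derivAt (ξ : OnePoint C) (i : ℕ) (f : HahnSeries ℚ C) :
    (derivAt ξ)^[i] f = (derivLin ξ ^ i) f := by
  rw [Module.End.pow_apply]
  rfl

/-- The action of an operator on series, as a linear map. -/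
def actLin (ξ : OnePoint C) (P : DiffOp C) : HahnSeries ℚ C →ₗ[C] HahnSeries ℚ C where
  toFun := actAt ξ P
  map_add' f g := by
    induction P using induction_add with
    | add P Q hP hQ => rw [actAt_add, actAt_add, actAt_add, hP, hQ]; abel
    | mono i a =>
      rw [actAt_mono, actAt_mono, actAt_mono, iterate_derivAt, iterate_derivAt, iterate_derivAt,
        map_add, mul_add]
  map_smul' c f := by
    induction P using induction_add with
    | add P Q hP hQ => rw [actAt_add, actAt_add, hP, hQ, smul_add]
    | mono i a =>
      rw [actAt_mono, actAt_mono, iterate_derivAt, iterate_derivAt, map_smul, RingHom.id_apply,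
        ← HahnSeries.C_mul_eq_smul, ← HahnSeries.C_mul_eq_smul, mul_left_comm]

theorem actLin_apply (ξ : OnePoint C) (P : DiffOp C) (f : HahnSeries ℚ C) :
    actLin ξ P f = actAt ξ P f := rfl

variable [CharZero C]

theorem actAt_leftD (ξ : OnePoint C) (P : DiffOp C) (f : HahnSeries ℚ C) :
    actAt ξ (leftD P) f = derivAt ξ (actAt ξ P f) := by
  induction P using induction_add with
  | add P Q hP hQ =>
    rw [map_add, actAt_add, actAt_add, hP, hQ]
    exact (map_add (derivLin ξ) _ _).symm
  | mono i a =>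
    rw [leftD_mono, actAt_add, actAt_mono, actAt_mono, actAt_mono, expandAt_ratDeriv,
      Function.iterate_succ_apply']
    rw [derivAt_mul]
    ring

theorem actAt_mul (ξ : OnePoint C) (P Q : DiffOp C) (f : HahnSeries ℚ C) :
    actAt ξ (P * Q) f = actAt ξ P (actAt ξ Q f) := by
  change actAt ξ (mulHom P Q) f = _
  have hi : ∀ i, actAt ξ (leftD^[i] Q) f = (derivAt ξ)^[i] (actAt ξ Q f) := by
    intro i
    induction i with
    | zero => rfl
    | succ i ih => rw [Function.iterate_succ_apply', actAt_leftD, ih, Function.iterate_succ_apply']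
  induction P using induction_add with
  | add P R hP hR => rw [map_add, AddMonoidHom.add_apply, actAt_add, actAt_add, hP, hR]
  | mono i a => rw [mulHom_mono, actAt_smul, hi, actAt_mono]

theorem actAt_eq_of_cls_eq {L P Q : DiffOp C} (h : L.cls P = L.cls Q) {ξ : OnePoint C}
    {f : HahnSeries ℚ C} (hf : actAt ξ L f = 0) : actAt ξ P f = actAt ξ Q f := by
  obtain ⟨R, hR⟩ := Submodule.mem_span_singleton.1 ((Submodule.Quotient.eq _).1 h)
  have h1 : P = R * L + Q := by rw [← smul_eq_mul, hR, sub_add_cancel]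
  rw [h1, actAt_add, actAt_mul, hf, ← actLin_apply, map_zero, zero_add]

theorem isIntegralAt_cls {L : DiffOp C} {ξ : OnePoint C} {P : DiffOp C} :
    IsIntegralAt ξ (L.cls P) ↔
      ∀ f, L.IsPuiseuxSolution ξ f → IsIntegralSeries (actAt ξ P f) :=
  ⟨fun h f hf => h P rfl f hf, fun h Q hQ f hf => by
    rw [actAt_eq_of_cls_eq hQ hf.2]; exact h f hf⟩

end DiffOp

/-! ### Integral series and local parameters -/

section Integrality

variable {C : Type*} [Field C]

/-- The valuation ring of integral series. -/
def integralSeries (C : Type*) [Field C] : Subring (HahnSeries ℚ C) where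
  carrier := {f | IsIntegralSeries f}
  zero_mem' := by simp [IsIntegralSeries]
  one_mem' := by simp [IsIntegralSeries]
  add_mem' {f g} hf hg := by
    change 0 ≤ (f + g).orderTop
    exact (le_min hf hg).trans HahnSeries.min_orderTop_le_orderTop_add
  neg_mem' {f} hf := by
    change 0 ≤ (-f).orderTop
    rwa [HahnSeries.orderTop_neg]
  mul_mem' {f g} hf hg := by
    change 0 ≤ (f * g).orderTop
    exact (add_nonneg hf hg).trans HahnSeries.orderTop_add_le_mul

theorem mem_integralSeries {f : HahnSeries ℚ C} : f ∈ integralSeries C ↔ 0 ≤ f.orderTop := Iff.rfl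

theorem mem_integralSeries_iff_coeff {f : HahnSeries ℚ C} :
    f ∈ integralSeries C ↔ ∀ e < 0, f.coeff e = 0 := by
  rw [mem_integralSeries, HahnSeries.le_orderTop_iff_forall]
  exact ⟨fun h e he => h e (by exact_mod_cast he), fun h e he => h e (by exact_mod_cast he)⟩

theorem C_mem_integralSeries (c : C) : HahnSeries.C c ∈ integralSeries C := by
  rw [mem_integralSeries_iff_coeff]
  intro e he
  rw [HahnSeries.C_apply, HahnSeries.coeff_single_of_ne he.ne]

theorem single_mem_integralSeries {e : ℚ} (he : 0 ≤ e) (c : C) :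
    HahnSeries.single e c ∈ integralSeries C := by
  rw [mem_integralSeries_iff_coeff]
  intro e' he'
  rw [HahnSeries.coeff_single_of_ne (he'.trans_le he).ne]

theorem smul_mem_integralSeries (c : C) {f : HahnSeries ℚ C} (hf : f ∈ integralSeries C) :
    c • f ∈ integralSeries C := by
  rw [← HahnSeries.C_mul_eq_smul]
  exact mul_mem (C_mem_integralSeries c) hf

/-- The constant coefficient of a product of integral series. -/
theorem coeff_zero_mul {f g : HahnSeries ℚ C} (hf : f ∈ integralSeries C)
    (hg : g ∈ integralSeries C) : (f * g).coeff 0 = f.coeff 0 * g.coeff 0 := by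
  rw [mem_integralSeries_iff_coeff] at hf hg
  rw [HahnSeries.coeff_mul]
  refine Finset.sum_eq_single (0, 0) ?_ ?_
  · rintro ⟨a, b⟩ hab hne
    obtain ⟨ha, hb, h⟩ := Finset.mem_antidiagonal.1 hab
    refine absurd ?_ hne
    have ha' : 0 ≤ a := not_lt.1 fun h' => ha (hf a h')
    have hb' : 0 ≤ b := not_lt.1 fun h' => hb (hg b h')
    simp only at h
    ext <;> simp only <;> linarith
  · intro h
    by_contra h0
    exact h (Finset.mem_antidiagonal.2
      ⟨left_ne_zero_of_mul h0, right_ne_zero_of_mul h0, add_zero 0⟩)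

/-- A nonzero series has a least exponent, and finitely many series share a lower bound. -/
theorem exists_single_mul_mem {ι : Type*} [Finite ι] (g : ι → HahnSeries ℚ C) :
    ∃ n : ℕ, ∀ m, n ≤ m → ∀ i, HahnSeries.single (1 : ℚ) (1 : C) ^ m * g i ∈ integralSeries C := by
  have h : ∀ i, ∃ n : ℕ, ∀ e ∈ (g i).support, -(n : ℚ) ≤ e := by
    intro i
    by_cases h0 : g i = 0
    · exact ⟨0, by simp [h0]⟩
    · obtain ⟨n, hn⟩ := exists_nat_ge (-(g i).order)
      exact ⟨n, fun e he => by linarith [HahnSeries.order_le_of_coeff_ne_zero he]⟩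
  choose n hn using h
  obtain ⟨N, hN⟩ := Finite.exists_le n
  refine ⟨N, fun m hm i => ?_⟩
  rw [mem_integralSeries_iff_coeff]
  intro e he
  rw [HahnSeries.single_pow, one_pow, HahnSeries.coeff_single_mul, one_mul]
  by_contra h
  have h1 := hn i _ h
  have h2 : ((n i : ℕ) : ℚ) ≤ m := by exact_mod_cast (hN i).trans hm
  rw [nsmul_eq_mul, mul_one] at h1
  linarith

/-- A local parameter at `ξ`. -/
def localParam (ξ : OnePoint C) : RatFunc C :=
  ξ.elim RatFunc.X⁻¹ fun c => algebraMap C[X] (RatFunc C) (X - Polynomial.C c)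

theorem localParam_infty : localParam (OnePoint.infty : OnePoint C) = RatFunc.X⁻¹ := rfl

theorem localParam_coe (c : C) :
    localParam (c : OnePoint C) = algebraMap C[X] (RatFunc C) (X - Polynomial.C c) := rfl

theorem expandAt_localParam (ξ : OnePoint C) :
    expandAt ξ (localParam ξ) = HahnSeries.single 1 1 := by
  induction ξ using OnePoint.rec with
  | infty =>
    rw [localParam_infty, map_inv₀, expandAt_X, xAt_infty]
    refine inv_eq_of_mul_eq_one_right ?_
    rw [HahnSeries.single_mul_single]
    simp
  | coe c =>
    rw [localParam_coe, expandAt_algebraMap, eval₂_sub, eval₂_X, eval₂_C, xAt_coe,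
      add_sub_cancel_left]

theorem expandAt_algebraMap_mem (c : C) (p : C[X]) :
    expandAt (c : OnePoint C) (algebraMap C[X] (RatFunc C) p) ∈ integralSeries C := by
  rw [expandAt_algebraMap, eval₂_eq_sum_range]
  refine sum_mem fun i _ => mul_mem (C_mem_integralSeries _) (pow_mem ?_ _)
  exact add_mem (C_mem_integralSeries c) (single_mem_integralSeries zero_le_one 1)

end Integrality

/-! ### Nonvanishing of the Wronskian -/

section Wronskian

variable {C : Type*} [Field C] [CharZero C]

/-- If the last coefficient is nonzero, normalise it to 1. Differentiating each relation and
subtracting the next one leaves a relation among the first n series whose coefficients are the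
derivatives of the old ones. By induction these vanish, so the coefficients are constants, and the
relation for k = 0 contradicts independence over C. -/
theorem eq_zero_of_sum_mul_iterate_derivAt_eq_zero (ξ : OnePoint C) (n : ℕ) :
    ∀ f : Fin n → HahnSeries ℚ C, LinearIndependent C f → ∀ h : Fin n → HahnSeries ℚ C,
      (∀ k < n, ∑ j, h j * (derivAt ξ)^[k] (f j) = 0) → h = 0 := by
  induction n with
  | zero => intro f _ h _; exact Subsingleton.elim _ _
  | succ n ih =>
    intro f hf h hh
    have hf' : LinearIndependent C (fun j : Fin n => f j.castSucc) :=
      hf.comp _ (Fin.castSucc_injective n)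
    by_cases hl : h (Fin.last n) = 0
    · have h1 := ih _ hf' (fun j => h j.castSucc) fun k hk => by
        have := hh k (hk.trans n.lt_succ_self)
        rwa [Fin.sum_univ_castSucc, hl, zero_mul, add_zero] at this
      funext j
      refine Fin.lastCases hl (fun i => congrFun h1 i) j
    · exfalso
      set g : Fin (n + 1) → HahnSeries ℚ C := fun j => h j / h (Fin.last n) with hg
      have hgl : g (Fin.last n) = 1 := div_self hl
      have hgg : ∀ k < n + 1, ∑ j, g j * (derivAt ξ)^[k] (f j) = 0 := by
        intro k hk
        simp only [hg, div_mul_eq_mul_div]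
        rw [← Finset.sum_div, hh k hk, zero_div]
      have h1 := derivAt_mul ξ (1 : HahnSeries ℚ C) 1
      rw [mul_one, one_mul, left_eq_add] at h1
      have h2 := ih _ hf' (fun j => derivAt ξ (g j.castSucc)) fun k hk => by
        have h3 := congrArg (derivLin ξ) (hgg k (hk.trans n.lt_succ_self))
        simp only [map_sum, map_zero, derivLin_apply, derivAt_mul, Finset.sum_add_distrib,
          ← Function.iterate_succ_apply'] at h3
        rw [hgg _ (Nat.succ_lt_succ hk), zero_add, Fin.sum_univ_castSucc, hgl, h1, mul_zero,
          add_zero] at h3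
        simpa only [mul_comm] using h3
      have h4 : ∀ j, ∃ c : C, g j = HahnSeries.C c :=
        Fin.lastCases ⟨1, by rw [hgl, map_one]⟩
          fun j => ⟨_, eq_C_of_derivAt_eq_zero (congrFun h2 j)⟩
      choose c hc using h4
      have h5 := hgg 0 n.succ_pos
      simp only [hc, Function.iterate_zero, id, HahnSeries.C_mul_eq_smul] at h5
      have h6 := Fintype.linearIndependent_iff.1 hf c h5 (Fin.last n)
      have h7 := hc (Fin.last n)
      rw [hgl, h6, map_zero] at h7
      exact one_ne_zero h7

/-- The Wronskian matrix of a family of series at `ξ`. -/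
def wronskianMatrix (ξ : OnePoint C) {n : ℕ} (f : Fin n → HahnSeries ℚ C) :
    Matrix (Fin n) (Fin n) (HahnSeries ℚ C) :=
  Matrix.of fun k j => (derivAt ξ)^[k] (f j)

theorem det_wronskianMatrix_ne_zero (ξ : OnePoint C) {n : ℕ} {f : Fin n → HahnSeries ℚ C}
    (hf : LinearIndependent C f) : (wronskianMatrix ξ f).det ≠ 0 := by
  intro h
  obtain ⟨v, hv, hv'⟩ := Matrix.exists_mulVec_eq_zero_iff.2 h
  refine hv (eq_zero_of_sum_mul_iterate_derivAt_eq_zero ξ n f hf v fun k hk => ?_)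
  simpa [Matrix.mulVec, dotProduct, wronskianMatrix, mul_comm] using congrFun hv' ⟨k, hk⟩

end Wronskian

/-! ### Solution spaces, generators of the quotient, and local bounds on poles -/

namespace DiffOp

variable {C : Type*} [Field C]

theorem actAt_eq_sum_fin (ξ : OnePoint C) (P : DiffOp C) (f : HahnSeries ℚ C) :
    actAt ξ P f = ∑ i : Fin (P.order + 1), expandAt ξ (P.toPoly.coeff i) * (derivAt ξ)^[i] f :=
  (sum_fin (S := HahnSeries ℚ C) (fun i a => expandAt ξ a * (derivAt ξ)^[i] f)
    (fun i => by rw [map_zero, zero_mul])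
    (degree_le_natDegree.trans_lt (by exact_mod_cast Nat.lt_succ_self _))).symm

theorem coeff_order_ne_zero {L : DiffOp C} (hL0 : L ≠ 0) : L.toPoly.coeff L.order ≠ 0 :=
  Polynomial.leadingCoeff_ne_zero.2 hL0

/-- Otherwise there would be ord L + 1 independent solutions, with an invertible Wronskian matrix.
But the nonzero vector of coefficients of L annihilates that matrix from the left. -/
theorem mem_span_of_actAt_eq_zero [CharZero C] {L : DiffOp C} (hL0 : L ≠ 0) {ξ : OnePoint C}
    {f : Fin L.order → HahnSeries ℚ C} (hf : LinearIndependent C f) (hf0 : ∀ i, actAt ξ L (f i) = 0)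
    {g : HahnSeries ℚ C} (hg : actAt ξ L g = 0) : g ∈ Submodule.span C (Set.range f) := by
  by_contra hgs
  have hli : LinearIndependent C (Fin.snoc f g : Fin (L.order + 1) → HahnSeries ℚ C) :=
    linearIndependent_finSnoc.2 ⟨hf, hgs⟩
  refine det_wronskianMatrix_ne_zero ξ hli (Matrix.exists_vecMul_eq_zero_iff.1
    ⟨fun k => expandAt ξ (L.toPoly.coeff k), fun h => ?_, ?_⟩)
  · have h1 := congrFun h (Fin.last _)
    exact coeff_order_ne_zero hL0 ((map_eq_zero _).1 h1)
  · funext j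
    change ∑ k : Fin (L.order + 1), expandAt ξ (L.toPoly.coeff k) *
      (derivAt ξ)^[k] ((Fin.snoc f g : Fin (L.order + 1) → HahnSeries ℚ C) j) = 0
    rw [← actAt_eq_sum_fin]
    refine Fin.lastCases ?_ (fun i => ?_) j
    · rw [Fin.snoc_last, hg]
    · rw [Fin.snoc_castSucc, hf0]

/-- The operator with the given coefficients. -/
def ofCoeffs {n : ℕ} (c : Fin n → RatFunc C) : DiffOp C :=
  ∑ k : Fin n, mono k (c k)

theorem actAt_ofCoeffs (ξ : OnePoint C) {n : ℕ} (c : Fin n → RatFunc C) (f : HahnSeries ℚ C) :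
    actAt ξ (ofCoeffs c) f = ∑ k : Fin n, expandAt ξ (c k) * (derivAt ξ)^[k] f := by
  have h : ∀ s : Finset (Fin n), actAt ξ (∑ k ∈ s, mono k (c k)) f =
      ∑ k ∈ s, expandAt ξ (c k) * (derivAt ξ)^[k] f := by
    intro s
    induction s using Finset.cons_induction with
    | empty => exact actAt_zero ξ f
    | cons a s ha ih => rw [Finset.sum_cons, Finset.sum_cons, actAt_add, ih, actAt_mono]
  exact h _

theorem smul_ofCoeffs {n : ℕ} (a : RatFunc C) (c : Fin n → RatFunc C) :
    a • ofCoeffs c = ofCoeffs fun k => a * c k := by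
  simp only [ofCoeffs, Finset.smul_sum, smul_mono]

theorem smul_cls {L : DiffOp C} (a : RatFunc C) (P : DiffOp C) : a • L.cls P = L.cls (a • P) := rfl

theorem cls_ofCoeffs {L : DiffOp C} {n : ℕ} (c : Fin n → RatFunc C) :
    L.cls (ofCoeffs c) = ∑ k, c k • L.cls (mono k 1) := by
  simp only [smul_cls, smul_mono, mul_one]
  exact map_sum (Submodule.mkQ (Submodule.span (DiffOp C) {L})) _ _

theorem mono_coeff_sum (P : DiffOp C) :
    P = ∑ k ∈ Finset.range (P.order + 1), mono k (P.toPoly.coeff k) :=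
  Polynomial.as_sum_range' P _ (Nat.lt_succ_self _)

theorem D_mul_mono (k : ℕ) (a : RatFunc C) :
    D * mono k a = mono k (ratDeriv C a) + mono (k + 1) a := by
  change mulHom (mono 1 1) _ = _
  rw [mulHom_mono, one_smul, Function.iterate_one, leftD_mono]

theorem D_smul_smul {L : DiffOp C} (a : RatFunc C) (m : L.Quot) :
    (D : DiffOp C) • a • m = ratDeriv C a • m + a • ((D : DiffOp C) • m) := by
  obtain ⟨P, rfl⟩ := Submodule.Quotient.mk_surjective _ m
  change L.cls (D * (a • P)) = L.cls (ratDeriv C a • P + a • (D * P))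
  have hD : ∀ Q : DiffOp C, D * Q = leftD Q := fun Q => by
    change mulHom (mono 1 1) _ = _
    rw [mulHom_mono, one_smul, Function.iterate_one]
  rw [hD, hD, leftD_smul]

/-- The relation [L] = 0 expresses the class of D^r through lower powers, so the span S is closed
under D. It contains the class of 1, hence those of all powers of D. -/
theorem span_cls_mono_eq_top {L : DiffOp C} (hL0 : L ≠ 0) :
    Submodule.span (RatFunc C) (Set.range fun k : Fin L.order => L.cls (mono k 1)) = ⊤ := by
  set S := Submodule.span (RatFunc C) (Set.range fun k : Fin L.order => L.cls (mono k 1)) with hS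
  have hlt : ∀ k < L.order, ∀ a, L.cls (mono k a) ∈ S := by
    intro k hk a
    rw [← mul_one a, ← smul_mono, ← smul_cls]
    exact S.smul_mem _ (Submodule.subset_span ⟨⟨k, hk⟩, rfl⟩)
  have heq : ∀ a, L.cls (mono L.order a) ∈ S := by
    intro a
    have h0 : L.cls L = 0 := (Submodule.Quotient.mk_eq_zero _).2 (Submodule.mem_span_singleton_self L)
    have h1 : L.cls (mono L.order (L.toPoly.coeff L.order)) ∈ S := by
      have h2 := congrArg (Submodule.mkQ (Submodule.span (DiffOp C) {L})) (mono_coeff_sum L)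
      rw [map_sum, Finset.sum_range_succ] at h2
      have h3 := (h0.symm.trans h2).symm
      have h4 := eq_neg_of_add_eq_zero_right h3
      change Submodule.mkQ (Submodule.span (DiffOp C) {L}) _ ∈ S
      rw [h4]
      exact S.neg_mem (S.sum_mem fun k hk => hlt k (Finset.mem_range.1 hk) _)
    have h5 := S.smul_mem (a / L.toPoly.coeff L.order) h1
    rwa [smul_cls, smul_mono, div_mul_cancel₀ _ (coeff_order_ne_zero hL0)] at h5
  have hD : ∀ m ∈ S, (D : DiffOp C) • m ∈ S := by
    intro m hm
    induction hm using Submodule.span_induction with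
    | mem m hm =>
      obtain ⟨k, rfl⟩ := hm
      change L.cls (D * mono k 1) ∈ S
      rw [D_mul_mono]
      refine S.add_mem (x := L.cls _) (y := L.cls _) (hlt k k.2 _) ?_
      rcases (Nat.succ_le_of_lt k.2).lt_or_eq with h | h
      · exact hlt _ h _
      · have := heq 1
        rwa [← h] at this
    | zero => rw [smul_zero]; exact S.zero_mem
    | add x y _ _ hx hy => rw [smul_add]; exact S.add_mem hx hy
    | smul a x hx hx' =>
      rw [D_smul_smul]
      exact S.add_mem (S.smul_mem _ hx) (S.smul_mem _ hx')
  have hall : ∀ k, L.cls (mono k 1) ∈ S := by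
    intro k
    induction k with
    | zero =>
      -- For order 0 there are no generators, and [1] ∈ S has to come from the relation given by L
      -- itself.
      rcases L.order.eq_zero_or_pos with h | h
      · have := heq 1
        rwa [h] at this
      · exact hlt 0 h 1
    | succ k ih =>
      have h := hD _ ih
      change L.cls (D * mono k 1) ∈ S at h
      rw [D_mul_mono, Derivation.map_one_eq_zero] at h
      have h0 : (mono k (0 : RatFunc C) : DiffOp C) = 0 := map_zero (monomial k)
      rwa [h0, zero_add] at h
  rw [eq_top_iff]
  rintro m -
  obtain ⟨P, rfl⟩ := Submodule.Quotient.mk_surjective _ m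
  change L.cls P ∈ S
  rw [mono_coeff_sum P]
  change Submodule.mkQ (Submodule.span (DiffOp C) {L}) _ ∈ S
  rw [map_sum]
  refine S.sum_mem fun k _ => ?_
  have h := S.smul_mem (P.toPoly.coeff k) (hall k)
  rwa [smul_cls, smul_mono, mul_one] at h

theorem exists_cls_ofCoeffs_eq {L : DiffOp C} (hL0 : L ≠ 0) (m : L.Quot) :
    ∃ c : Fin L.order → RatFunc C, m = L.cls (ofCoeffs c) := by
  have h : m ∈ Submodule.span (RatFunc C) (Set.range fun k : Fin L.order => L.cls (mono k 1)) := by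
    rw [span_cls_mono_eq_top hL0]; trivial
  obtain ⟨c, hc⟩ := (Submodule.mem_span_range_iff_exists_fun _).1 h
  exact ⟨c, by rw [cls_ofCoeffs, hc]⟩

variable [CharZero C]

/-- Every solution is a C-combination of the basis, and integral series are closed under such
combinations. -/
theorem isIntegralAt_cls_of_basis {L : DiffOp C} (hL0 : L ≠ 0) {ξ : OnePoint C}
    {f : Fin L.order → HahnSeries ℚ C} (hf : LinearIndependent C f)
    (hf0 : ∀ i, L.IsPuiseuxSolution ξ (f i)) {P : DiffOp C} :
    IsIntegralAt ξ (L.cls P) ↔ ∀ i, actAt ξ P (f i) ∈ integralSeries C := by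
  rw [isIntegralAt_cls]
  refine ⟨fun h i => h _ (hf0 i), fun h g hg => ?_⟩
  obtain ⟨c, rfl⟩ := (Submodule.mem_span_range_iff_exists_fun _).1
    (mem_span_of_actAt_eq_zero hL0 hf (fun i => (hf0 i).2) hg.2)
  change actLin ξ P _ ∈ integralSeries C
  rw [map_sum]
  refine sum_mem fun i _ => ?_
  rw [map_smul]
  exact smul_mem_integralSeries _ (h i)

/-- Every class becomes integral at `ξ` after multiplication by a power of the local parameter. -/
theorem exists_localParam_pow_smul_isIntegralAt {L : DiffOp C} (hL0 : L ≠ 0)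
    (hL : L.HasPuiseuxBases) (ξ : OnePoint C) {ι : Type*} [Finite ι] (P : ι → DiffOp C) :
    ∃ n : ℕ, ∀ m, n ≤ m → ∀ i, IsIntegralAt ξ (localParam ξ ^ m • L.cls (P i)) := by
  obtain ⟨f, hf, hf0⟩ := hL ξ
  obtain ⟨n, hn⟩ := exists_single_mul_mem fun p : ι × Fin L.order => actAt ξ (P p.1) (f p.2)
  refine ⟨n, fun m hm i => ?_⟩
  rw [smul_cls, isIntegralAt_cls_of_basis hL0 hf hf0]
  intro j
  rw [actAt_smul, map_pow, expandAt_localParam]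
  exact hn m hm (i, j)

/-- The coefficients of the classes that are integral at `ξ` have bounded pole orders. -/
theorem exists_localParam_pow_mul_coeff_mem {L : DiffOp C} (hL : L.HasPuiseuxBases)
    (ξ : OnePoint C) :
    ∃ n : ℕ, ∀ m, n ≤ m → ∀ c : Fin L.order → RatFunc C, IsIntegralAt ξ (L.cls (ofCoeffs c)) →
      ∀ k, expandAt ξ (localParam ξ ^ m * c k) ∈ integralSeries C := by
  obtain ⟨f, hf, hf0⟩ := hL ξ
  set W := wronskianMatrix ξ f with hW
  -- Applying the operator to the basis gives the row vector c · W, which is integral. Hence c = (c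
  -- · W) · W⁻¹ has poles no worse than those of W⁻¹, a bound independent of c.
  obtain ⟨n, hn⟩ := exists_single_mul_mem fun p : Fin L.order × Fin L.order => W⁻¹ p.1 p.2
  refine ⟨n, fun m hm c hc k => ?_⟩
  have hu : IsUnit W.det := (det_wronskianMatrix_ne_zero ξ hf).isUnit
  have h1 : ∀ j, Matrix.vecMul (fun k => expandAt ξ (c k)) W j ∈ integralSeries C := by
    intro j
    have h2 := isIntegralAt_cls.1 hc (f j) (hf0 j)
    rw [actAt_ofCoeffs] at h2
    exact h2
  have h3 : expandAt ξ (c k) = ∑ j, Matrix.vecMul (fun k => expandAt ξ (c k)) W j * W⁻¹ j k := by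
    change _ = Matrix.vecMul (Matrix.vecMul (fun k => expandAt ξ (c k)) W) W⁻¹ k
    rw [Matrix.vecMul_vecMul, Matrix.mul_nonsing_inv _ hu, Matrix.vecMul_one]
  rw [map_mul, map_pow, expandAt_localParam, h3, Finset.mul_sum]
  refine sum_mem fun j _ => ?_
  rw [mul_left_comm]
  exact mul_mem (h1 j) (hn m hm (j, k))

end DiffOp

/-! ### Power series expansions and iterated derivatives at a finite point -/

section Regular

variable {C : Type*} [Field C]

theorem support_ofPowerSeries (F : PowerSeries C) {e : ℚ}
    (he : (HahnSeries.ofPowerSeries ℚ C F).coeff e ≠ 0) : ∃ n : ℕ, e = n := by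
  by_contra h
  refine he ?_
  rw [HahnSeries.ofPowerSeries_apply]
  refine HahnSeries.embDomain_of_notMem_range ?_
  rintro ⟨n, hn⟩
  exact h ⟨n, hn.symm⟩

/-- A rational function without a pole at `c` expands to a power series. -/
theorem exists_expandAt_eq_ofPowerSeries (c : C) {a : RatFunc C} (ha : a.denom.eval c ≠ 0) :
    ∃ F, expandAt (c : OnePoint C) a = HahnSeries.ofPowerSeries ℚ C F := by
  have h : ∀ p : C[X], expandAt (c : OnePoint C) (algebraMap C[X] (RatFunc C) p) =
      HahnSeries.ofPowerSeries ℚ C (p.eval₂ PowerSeries.C (PowerSeries.C c + PowerSeries.X)) := by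
    intro p
    rw [expandAt_algebraMap, hom_eval₂, map_add, HahnSeries.ofPowerSeries_C,
      HahnSeries.ofPowerSeries_X, xAt_coe]
    congr 1
    ext1 x
    exact (HahnSeries.ofPowerSeries_C x).symm
  -- The constant coefficient is the value of the denominator at c.
  have hu : IsUnit (a.denom.eval₂ PowerSeries.C (PowerSeries.C c + PowerSeries.X)) := by
    rw [PowerSeries.isUnit_iff_constantCoeff, hom_eval₂, isUnit_iff_ne_zero]
    simpa [PowerSeries.constantCoeff_comp_C] using ha
  obtain ⟨v, hv⟩ := hu.exists_right_inv
  refine ⟨a.num.eval₂ PowerSeries.C (PowerSeries.C c + PowerSeries.X) * v, ?_⟩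
  have hv' := congrArg (HahnSeries.ofPowerSeries ℚ C) hv
  rw [map_mul, map_one, ← h] at hv'
  rw [map_mul, ← h, ← inv_eq_of_mul_eq_one_right hv', ← div_eq_mul_inv, ← map_div₀,
    RatFunc.num_div_denom]

theorem coeff_derivAt (c : C) (f : HahnSeries ℚ C) (e : ℚ) :
    (derivAt (c : OnePoint C) f).coeff e = ((e + 1 : ℚ) : C) * f.coeff (e + 1) := by
  rw [derivAt_coe, HahnSeries.coeff_single_mul, one_mul, coeff_eulerOp, sub_neg_eq_add]

theorem coeff_iterate_derivAt (c : C) (f : HahnSeries ℚ C) (k : ℕ) (e : ℚ) :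
    ((derivAt (c : OnePoint C))^[k] f).coeff e =
      (∏ i ∈ Finset.range k, ((e + 1 + i : ℚ) : C)) * f.coeff (e + k) := by
  induction k generalizing e with
  | zero => simp
  | succ k ih =>
    rw [Function.iterate_succ_apply', coeff_derivAt, ih, Finset.prod_range_succ']
    have h1 : e + 1 + (k : ℚ) = e + ((k + 1 : ℕ) : ℚ) := by push_cast; ring
    have h2 : ∀ i : ℕ, e + 1 + 1 + (i : ℚ) = e + 1 + ((i + 1 : ℕ) : ℚ) := fun i => by
      push_cast; ring
    simp only [h1, h2, Nat.cast_zero, add_zero]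
    ring

variable [CharZero C]

theorem iterate_derivAt_mem_integralSeries (c : C) {f : HahnSeries ℚ C}
    (hf : ∀ e ∈ f.support, ∃ n : ℕ, e = n) (k : ℕ) :
    (derivAt (c : OnePoint C))^[k] f ∈ integralSeries C := by
  rw [mem_integralSeries_iff_coeff]
  intro e he
  rw [coeff_iterate_derivAt]
  by_contra h
  obtain ⟨n, hn⟩ := hf _ (right_ne_zero_of_mul h)
  have hnk : n < k := by
    have : (n : ℚ) < k := by linarith
    exact_mod_cast this
  -- With e + k = n < k, the factor e + 1 + i vanishes for i = k - n - 1: the k-th derivative of t^n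
  -- is zero.
  refine left_ne_zero_of_mul h (Finset.prod_eq_zero (i := k - n - 1)
    (Finset.mem_range.2 (by omega)) ?_)
  rw [Nat.cast_sub (by omega), Nat.cast_sub hnk.le, Rat.cast_eq_zero]
  push_cast
  linarith

end Regular

/-! ### Solutions at ordinary points -/

namespace DiffOp

variable {C : Type*} [Field C]

/-- No coefficient of the monic associate of `L` has a pole at `c`. -/
def IsOrdinaryPoint (L : DiffOp C) (c : C) : Prop :=
  ∀ k : Fin L.order, (-(L.toPoly.coeff k / L.toPoly.coeff L.order)).denom.eval c ≠ 0

theorem iterate_derivAt_order {L : DiffOp C} (hL0 : L ≠ 0) {ξ : OnePoint C} {f : HahnSeries ℚ C}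
    (hf : actAt ξ L f = 0) :
    (derivAt ξ)^[L.order] f = ∑ k : Fin L.order,
      expandAt ξ (-(L.toPoly.coeff k / L.toPoly.coeff L.order)) * (derivAt ξ)^[k] f := by
  have hl : expandAt ξ (L.toPoly.coeff L.order) ≠ 0 :=
    (_root_.map_ne_zero _).2 (coeff_order_ne_zero hL0)
  rw [actAt_eq_sum_fin, Fin.sum_univ_castSucc] at hf
  refine mul_left_cancel₀ hl ((eq_neg_of_add_eq_zero_right hf).trans ?_)
  rw [Finset.mul_sum, ← Finset.sum_neg_distrib]
  refine Finset.sum_congr rfl fun k _ => ?_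
  rw [map_neg, map_div₀, Fin.val_castSucc]
  field_simp

/-- All but finitely many points are ordinary. -/
theorem finite_not_isOrdinaryPoint (L : DiffOp C) : {c : C | ¬ L.IsOrdinaryPoint c}.Finite := by
  have h : {c : C | ¬ L.IsOrdinaryPoint c} = ⋃ k : Fin L.order,
      {c | (-(L.toPoly.coeff k / L.toPoly.coeff L.order)).denom.IsRoot c} := by
    ext c
    simp [IsOrdinaryPoint, IsRoot]
  rw [h]
  exact Set.finite_iUnion fun k => finite_setOfPred_isRoot (RatFunc.denom_ne_zero _)

variable [CharZero C]

/-- Solve L · f = 0 for the r-th derivative, r = ord L, and compare coefficients at t^(e-r). On the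
left stands e(e-1)⋯(e-r+1) times the coefficient of f at e, nonzero because e is none of 0, …, r-1.
The coefficients on the right are power series, so only exponents e - r - n + k with k < r occur
there, each below e by a positive integer. -/
theorem exists_lt_mem_support {L : DiffOp C} (hL0 : L ≠ 0) {c : C} (hc : L.IsOrdinaryPoint c)
    {f : HahnSeries ℚ C} (hf : actAt (c : OnePoint C) L f = 0) {e : ℚ} (he : e ∈ f.support)
    (hne : ∀ k < L.order, e ≠ k) : ∃ n : ℕ, e - (n + 1) ∈ f.support := by
  have h1 := congrArg (fun g => g.coeff (e - L.order)) (iterate_derivAt_order hL0 hf)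
  simp only [coeff_iterate_derivAt, sub_add_cancel, HahnSeries.coeff_sum] at h1
  have h2 : (∏ i ∈ Finset.range L.order, ((e - L.order + 1 + i : ℚ) : C)) * f.coeff e ≠ 0 := by
    refine mul_ne_zero (Finset.prod_ne_zero_iff.2 fun i hi h0 => ?_) he
    rw [Finset.mem_range] at hi
    refine hne (L.order - 1 - i) (by omega) ?_
    rw [Nat.cast_sub (by omega), Nat.cast_sub (by omega)]
    rw [Rat.cast_eq_zero] at h0
    push_cast
    linarith
  rw [h1] at h2
  obtain ⟨k, -, hk⟩ := Finset.exists_ne_zero_of_sum_ne_zero h2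
  obtain ⟨a, ha, b, hb, hab⟩ := HahnSeries.support_mul_subset hk
  obtain ⟨F, hF⟩ := exists_expandAt_eq_ofPowerSeries c (hc k)
  rw [hF] at ha
  obtain ⟨n, rfl⟩ := support_ofPowerSeries F ha
  rw [HahnSeries.mem_support, coeff_iterate_derivAt] at hb
  refine ⟨L.order + n - k - 1, ?_⟩
  have hk := k.2
  rw [Nat.cast_sub (by omega), Nat.cast_sub (by omega)]
  have h3 : e - ((((L.order + n : ℕ) : ℚ) - (k : ℕ) - (1 : ℕ)) + 1) = b + (k : ℕ) := by
    simp only at hab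
    push_cast
    linarith
  rw [h3]
  exact right_ne_zero_of_mul hb

/-- An exponent of a solution at an ordinary point exceeds by a natural number one of its
exponents among `0, …, r - 1`. -/
theorem exists_mem_support_lt_order {L : DiffOp C} (hL0 : L ≠ 0) {c : C}
    (hc : L.IsOrdinaryPoint c) {f : HahnSeries ℚ C} (hf : actAt (c : OnePoint C) L f = 0) {e : ℚ}
    (he : e ∈ f.support) : ∃ k < L.order, ((k : ℕ) : ℚ) ∈ f.support ∧ ∃ n : ℕ, e = k + n := by
  -- The support of a Hahn series is well-founded, so the descent to smaller exponents must stop,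
  -- and it can only stop among 0, …, r - 1.
  refine Set.WellFoundedOn.induction
    (P := fun e => ∃ k < L.order, ((k : ℕ) : ℚ) ∈ f.support ∧ ∃ n : ℕ, e = k + n)
    f.isWF_support he fun x hxs ih => ?_
  by_cases hx : ∃ k < L.order, x = (k : ℕ)
  · obtain ⟨k, hk, rfl⟩ := hx
    exact ⟨k, hk, hxs, 0, by simp⟩
  · push Not at hx
    obtain ⟨n, hn⟩ := exists_lt_mem_support hL0 hc hf hxs hx
    obtain ⟨k, hk, hk', m, hm⟩ := ih _ hn
      (by linarith [(Nat.cast_nonneg n : (0 : ℚ) ≤ n)])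
    refine ⟨k, hk, hk', m + n + 1, ?_⟩
    push_cast
    linarith

theorem iterate_derivAt_mem_of_isOrdinaryPoint {L : DiffOp C} (hL0 : L ≠ 0) {c : C}
    (hc : L.IsOrdinaryPoint c) {f : HahnSeries ℚ C} (hf : actAt (c : OnePoint C) L f = 0) (k : ℕ) :
    (derivAt (c : OnePoint C))^[k] f ∈ integralSeries C := by
  refine iterate_derivAt_mem_integralSeries c (fun e he => ?_) k
  obtain ⟨j, -, -, n, rfl⟩ := exists_mem_support_lt_order hL0 hc hf he
  exact ⟨j + n, by push_cast; rfl⟩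

/-- At an ordinary point there are solutions with arbitrary initial values. -/
theorem exists_initial_values {L : DiffOp C} (hL0 : L ≠ 0) {c : C} (hc : L.IsOrdinaryPoint c)
    {f : Fin L.order → HahnSeries ℚ C} (hf : LinearIndependent C f)
    (hf0 : ∀ i, actAt (c : OnePoint C) L (f i) = 0) (v : Fin L.order → C) :
    ∃ g ∈ Submodule.span C (Set.range f), actAt (c : OnePoint C) L g = 0 ∧
      ∀ k : Fin L.order, g.coeff (k : ℕ) = v k := by
  -- Φ sends coordinates of a solution to its coefficients at 0, …, r - 1. If these all vanish the
  -- support is empty, so Φ is injective, hence surjective by dimension.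
  let Φ : (Fin L.order → C) →ₗ[C] (Fin L.order → C) :=
    { toFun := fun a k => (∑ j, a j • f j).coeff (k : ℕ)
      map_add' := fun a b => by
        funext k
        simp [add_smul, Finset.sum_add_distrib]
      map_smul' := fun t a => by
        funext k
        simp [HahnSeries.coeff_sum, mul_assoc, Finset.mul_sum] }
  have hsol : ∀ a : Fin L.order → C, actAt (c : OnePoint C) L (∑ j, a j • f j) = 0 := by
    intro a
    rw [← actLin_apply, map_sum]
    refine Finset.sum_eq_zero fun j _ => ?_
    rw [map_smul, actLin_apply, hf0, smul_zero]
  have hinj : Function.Injective Φ := by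
    rw [← LinearMap.ker_eq_bot, LinearMap.ker_eq_bot']
    intro a ha
    have h0 : ∑ j, a j • f j = 0 := by
      ext e
      by_contra he
      obtain ⟨k, hk, hk', -⟩ := exists_mem_support_lt_order hL0 hc (hsol a) he
      exact hk' (congrFun ha ⟨k, hk⟩)
    funext j
    exact Fintype.linearIndependent_iff.1 hf a h0 j
  obtain ⟨a, ha⟩ := LinearMap.injective_iff_surjective.1 hinj v
  exact ⟨∑ j, a j • f j, Submodule.sum_mem _ fun j _ =>
    Submodule.smul_mem _ _ (Submodule.subset_span ⟨j, rfl⟩), hsol a, fun k => congrFun ha k⟩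

/-- At an ordinary point, the classes of `1, D, …, D^(r-1)` form a local integral basis. -/
theorem isIntegralAt_ofCoeffs_iff {L : DiffOp C} (hL0 : L ≠ 0) (hL : L.HasPuiseuxBases) {c : C}
    (hc : L.IsOrdinaryPoint c) (a : Fin L.order → RatFunc C) :
    IsIntegralAt (c : OnePoint C) (L.cls (ofCoeffs a)) ↔
      ∀ k, expandAt (c : OnePoint C) (a k) ∈ integralSeries C := by
  constructor
  · intro h
    by_contra hne
    push Not at hne
    obtain ⟨k₁, hk₁⟩ := hne
    have : Nonempty (Fin L.order) := ⟨k₁⟩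
    -- Take the coefficient with the worst pole, of order e < 0, and a solution g whose only nonzero
    -- initial coefficient is the one at k₀. In the coefficient of P · g at t^e only the term k₀
    -- survives, and it equals k₀! times the leading coefficient of that pole.
    obtain ⟨k₀, hk₀⟩ := Finite.exists_min fun k => (expandAt (c : OnePoint C) (a k)).orderTop
    have hlt : (expandAt (c : OnePoint C) (a k₀)).orderTop < 0 :=
      (hk₀ k₁).trans_lt (not_le.1 hk₁)
    obtain ⟨e, he⟩ := WithTop.ne_top_iff_exists.1 (hlt.trans (WithTop.coe_lt_top 0)).ne
    have he0 : e < 0 := by rw [← he] at hlt; exact_mod_cast hlt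
    obtain ⟨f, hf, hf0⟩ := hL c
    obtain ⟨g, hg, hg0, hgv⟩ := exists_initial_values hL0 hc hf (fun i => (hf0 i).2) (Pi.single k₀ 1)
    have hgi : actAt (c : OnePoint C) (ofCoeffs a) g ∈ integralSeries C := by
      obtain ⟨b, rfl⟩ := (Submodule.mem_span_range_iff_exists_fun _).1 hg
      rw [← actLin_apply, map_sum]
      refine sum_mem fun i _ => ?_
      rw [map_smul]
      exact smul_mem_integralSeries _ (isIntegralAt_cls.1 h _ (hf0 i))
    have hscale : ∀ x : HahnSeries ℚ C,
        (HahnSeries.single (-e) (1 : C) * x).coeff 0 = x.coeff e := by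
      intro x
      rw [HahnSeries.coeff_single_mul, one_mul, sub_neg_eq_add, zero_add]
    have hmem : ∀ k, HahnSeries.single (-e) (1 : C) * expandAt (c : OnePoint C) (a k)
        ∈ integralSeries C := by
      intro k
      rw [mem_integralSeries_iff_coeff]
      intro e' he'
      rw [HahnSeries.coeff_single_mul, one_mul]
      refine HahnSeries.coeff_eq_zero_of_lt_orderTop (lt_of_lt_of_le ?_ (hk₀ k))
      rw [← he]
      exact_mod_cast (by linarith : e' - -e < e)
    have h0 := mem_integralSeries_iff_coeff.1 hgi e he0
    rw [← hscale, actAt_ofCoeffs, Finset.mul_sum, HahnSeries.coeff_sum,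
      Finset.sum_eq_single k₀] at h0
    · rw [← mul_assoc, coeff_zero_mul (hmem k₀)
        (iterate_derivAt_mem_of_isOrdinaryPoint hL0 hc hg0 _), hscale, coeff_iterate_derivAt,
        zero_add (((k₀ : ℕ) : ℕ) : ℚ), hgv, Pi.single_eq_same, mul_one] at h0
      refine mul_ne_zero (HahnSeries.coeff_orderTop_ne he.symm)
        (Finset.prod_ne_zero_iff.2 fun i _ => ?_) h0
      rw [Rat.cast_ne_zero, zero_add]
      positivity
    · intro k _ hk
      rw [← mul_assoc, coeff_zero_mul (hmem k)
        (iterate_derivAt_mem_of_isOrdinaryPoint hL0 hc hg0 _), coeff_iterate_derivAt,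
        zero_add (((k : ℕ) : ℕ) : ℚ), hgv, Pi.single_eq_of_ne hk, mul_zero, mul_zero]
    · exact fun h => absurd (Finset.mem_univ _) h
  · intro h
    rw [isIntegralAt_cls]
    intro f hf
    rw [actAt_ofCoeffs]
    exact sum_mem (S := integralSeries C) fun k _ =>
      mul_mem (h k) (iterate_derivAt_mem_of_isOrdinaryPoint hL0 hc hf.2 _)

end DiffOp

/-! ### Degrees, values and poles read off from expansions -/

section Expansions

variable {C : Type*} [Field C]

theorem single_pow_mul_expandAt_infty_mem {p : C[X]} {d : ℕ} (hd : p.natDegree ≤ d) :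
    HahnSeries.single (1 : ℚ) (1 : C) ^ d *
      expandAt (OnePoint.infty : OnePoint C) (algebraMap C[X] (RatFunc C) p) ∈ integralSeries C := by
  rw [expandAt_algebraMap, eval₂_eq_sum_range' _ (Nat.lt_succ_of_le hd), Finset.mul_sum]
  refine sum_mem fun i hi => ?_
  have hi' : (i : ℚ) ≤ d := by exact_mod_cast Nat.le_of_lt_succ (Finset.mem_range.1 hi)
  rw [mul_left_comm, xAt_infty, HahnSeries.single_pow, HahnSeries.single_pow,
    HahnSeries.single_mul_single]
  refine mul_mem (C_mem_integralSeries _) (single_mem_integralSeries ?_ _)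
  rw [nsmul_eq_mul, nsmul_eq_mul]
  linarith

/-- Since x = t⁻¹ at infinity, the leading term of p supplies the lowest power of t. -/
theorem order_expandAt_infty {p : C[X]} (hp : p ≠ 0) :
    (expandAt (OnePoint.infty : OnePoint C) (algebraMap C[X] (RatFunc C) p)).order =
      -(p.natDegree : ℚ) := by
  have h0 := eval₂_xAt_ne_zero OnePoint.infty p hp
  apply le_antisymm
  · refine HahnSeries.order_le_of_coeff_ne_zero ?_
    rw [expandAt_algebraMap, xAt_infty, ← mul_neg_one (p.natDegree : ℚ),
      coeff_eval₂_single (neg_ne_zero.2 one_ne_zero)]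
    exact Polynomial.leadingCoeff_ne_zero.2 hp
  · have h := HahnSeries.zero_le_orderTop_iff.1 (single_pow_mul_expandAt_infty_mem (le_refl p.natDegree))
    rw [HahnSeries.order_mul (pow_ne_zero _ (HahnSeries.single_ne_zero one_ne_zero))
      (by rwa [expandAt_algebraMap]), HahnSeries.order_pow, HahnSeries.order_single one_ne_zero,
      nsmul_eq_mul] at h
    linarith

theorem expandAt_infty_mem {f : RatFunc C} (hf : f ∈ DiffOp.ratAtInfinity C) :
    expandAt (OnePoint.infty : OnePoint C) f ∈ integralSeries C := by
  obtain ⟨u, v, hv, huv, rfl⟩ := hf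
  by_cases hu : u = 0
  · rw [hu, map_zero, zero_div, map_zero]
    exact zero_mem _
  · have hd := natDegree_le_natDegree huv
    have hu' := eval₂_xAt_ne_zero OnePoint.infty u hu
    have hv' := eval₂_xAt_ne_zero OnePoint.infty v hv
    rw [← expandAt_algebraMap] at hu' hv'
    have h1 := div_mul_cancel₀ (expandAt (OnePoint.infty : OnePoint C) (algebraMap _ _ u)) hv'
    have h2 := congrArg HahnSeries.order h1
    rw [HahnSeries.order_mul (div_ne_zero hu' hv') hv', order_expandAt_infty hu,
      order_expandAt_infty hv] at h2
    rw [mem_integralSeries, HahnSeries.zero_le_orderTop_iff, map_div₀]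
    have hd' : (u.natDegree : ℚ) ≤ v.natDegree := by exact_mod_cast hd
    linarith

theorem coeff_zero_expandAt_algebraMap (c : C) (p : C[X]) :
    (expandAt (c : OnePoint C) (algebraMap C[X] (RatFunc C) p)).coeff 0 = p.eval c := by
  have hx : xAt (c : OnePoint C) ∈ integralSeries C := by
    rw [← expandAt_X, ← RatFunc.algebraMap_X]
    exact expandAt_algebraMap_mem c X
  rw [expandAt_algebraMap]
  induction p using Polynomial.induction_on with
  | C a => simp [HahnSeries.C_apply]
  | add p q hp hq => rw [eval₂_add, HahnSeries.coeff_add, hp, hq, eval_add]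
  | monomial n a h =>
    rw [pow_succ, ← mul_assoc, eval₂_mul, coeff_zero_mul ?_ (by rwa [eval₂_X]), h, eval₂_X,
      eval_mul (q := X), eval_X, xAt_coe]
    · simp [HahnSeries.C_apply]
    · rw [← expandAt_algebraMap]
      exact expandAt_algebraMap_mem c _

/-- A rational function without finite poles is a polynomial. -/
theorem exists_eq_algebraMap_of_forall_mem [IsAlgClosed C] {a : RatFunc C}
    (ha : ∀ c : C, expandAt (c : OnePoint C) a ∈ integralSeries C) :
    ∃ p : C[X], a = algebraMap C[X] (RatFunc C) p := by
  have hdeg : a.denom.degree = 0 := by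
    by_contra hne
    obtain ⟨c, hc⟩ := IsAlgClosed.exists_root _ hne
    have h1 : a * algebraMap C[X] (RatFunc C) a.denom = algebraMap C[X] (RatFunc C) a.num := by
      conv_lhs => enter [1]; rw [← RatFunc.num_div_denom a]
      exact div_mul_cancel₀ _ (RatFunc.algebraMap_ne_zero (RatFunc.denom_ne_zero a))
    -- At a root c of the denominator, integrality of a forces the numerator to vanish too, against
    -- coprimality.
    have h2 := congrArg (fun g => (expandAt (c : OnePoint C) g).coeff 0) h1
    simp only [map_mul] at h2
    rw [coeff_zero_mul (ha c) (expandAt_algebraMap_mem c _), coeff_zero_expandAt_algebraMap,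
      coeff_zero_expandAt_algebraMap, hc.eq_zero, mul_zero] at h2
    obtain ⟨s, t, hst⟩ := RatFunc.isCoprime_num_denom a
    have h3 := congrArg (eval c) hst
    rw [eval_add, eval_mul, eval_mul, ← h2, hc.eq_zero] at h3
    simp at h3
  have h1 : a.denom = 1 := (RatFunc.monic_denom a).eq_one_of_isUnit
    (Polynomial.isUnit_iff_degree_eq_zero.2 hdeg)
  refine ⟨a.num, ?_⟩
  conv_lhs => rw [← RatFunc.num_div_denom a, h1, map_one, div_one]

end Expansions

/-! ### The lattices of integral elements -/

namespace DiffOp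

variable {C : Type*} [Field C]

/-- The factor at one of the points of a product of powers of local parameters. -/
theorem algebraMap_prod_eq (S : Finset C) (n : C → ℕ) {c : C} (hc : c ∈ S) :
    ∃ p : C[X], algebraMap C[X] (RatFunc C) (∏ b ∈ S, (X - Polynomial.C b) ^ n b) =
      algebraMap C[X] (RatFunc C) p * localParam (c : OnePoint C) ^ n c := by
  classical
  refine ⟨∏ b ∈ S.erase c, (X - Polynomial.C b) ^ n b, ?_⟩
  rw [← Finset.prod_erase_mul _ _ hc, map_mul, map_pow, localParam_coe]

variable [CharZero C]

theorem isIntegralAt_zero {L : DiffOp C} (ξ : OnePoint C) : IsIntegralAt ξ (0 : L.Quot) := by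
  change IsIntegralAt ξ (L.cls 0)
  rw [isIntegralAt_cls]
  intro f _
  rw [actAt_zero]
  exact zero_mem (integralSeries C)

theorem IsIntegralAt.add {L : DiffOp C} {ξ : OnePoint C} {m n : L.Quot} (hm : IsIntegralAt ξ m)
    (hn : IsIntegralAt ξ n) : IsIntegralAt ξ (m + n) := by
  obtain ⟨P, rfl⟩ := Submodule.Quotient.mk_surjective _ m
  obtain ⟨Q, rfl⟩ := Submodule.Quotient.mk_surjective _ n
  change IsIntegralAt ξ (L.cls (P + Q))
  rw [isIntegralAt_cls]
  intro f hf
  rw [actAt_add]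
  exact (integralSeries C).add_mem (hm P rfl f hf) (hn Q rfl f hf)

theorem IsIntegralAt.smul {L : DiffOp C} {ξ : OnePoint C} {m : L.Quot} (hm : IsIntegralAt ξ m)
    {a : RatFunc C} (ha : expandAt ξ a ∈ integralSeries C) : IsIntegralAt ξ (a • m) := by
  obtain ⟨P, rfl⟩ := Submodule.Quotient.mk_surjective _ m
  change IsIntegralAt ξ (L.cls (a • P))
  rw [isIntegralAt_cls]
  intro f hf
  rw [actAt_smul]
  exact (integralSeries C).mul_mem ha (hm P rfl f hf)

/-- The `C[x]`-module of globally integral elements. -/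
def globallyIntegral (L : DiffOp C) : Submodule C[X] L.Quot where
  carrier := {m | IsGloballyIntegral m}
  zero_mem' := by
    intro c
    exact isIntegralAt_zero _
  add_mem' := by
    intro m n hm hn c
    exact (hm c).add (hn c)
  smul_mem' := by
    intro p _ hm c
    rw [← algebraMap_smul (RatFunc C) p]
    exact (hm c).smul (expandAt_algebraMap_mem c p)

theorem mem_globallyIntegral {L : DiffOp C} {m : L.Quot} :
    m ∈ globallyIntegral L ↔ IsGloballyIntegral m := Iff.rfl

/-- The `C(x)_∞`-module of elements that are integral at infinity. -/
def integralAtInfinity (L : DiffOp C) : Submodule (ratAtInfinity C) L.Quot where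
  carrier := {m | IsIntegralAt OnePoint.infty m}
  zero_mem' := isIntegralAt_zero _
  add_mem' := IsIntegralAt.add
  smul_mem' a _ hm := IsIntegralAt.smul (a := (a : RatFunc C)) hm (expandAt_infty_mem a.2)

theorem mem_integralAtInfinity {L : DiffOp C} {m : L.Quot} :
    m ∈ integralAtInfinity L ↔ IsIntegralAt OnePoint.infty m := Iff.rfl

/-- At ordinary points the powers of D are already integral, so only the finitely many other points
contribute factors. -/
theorem exists_smul_mem_globallyIntegral {L : DiffOp C} (hL0 : L ≠ 0) (hL : L.HasPuiseuxBases) :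
    ∃ p : C[X], p ≠ 0 ∧ ∀ k : Fin L.order, p • L.cls (mono k 1) ∈ globallyIntegral L := by
  choose n hn using fun c : C =>
    exists_localParam_pow_smul_isIntegralAt hL0 hL c fun k : Fin L.order => mono k 1
  have hfin := finite_not_isOrdinaryPoint L
  refine ⟨∏ b ∈ hfin.toFinset, (X - Polynomial.C b) ^ n b,
    Finset.prod_ne_zero_iff.2 fun b _ => pow_ne_zero _ (X_sub_C_ne_zero b), fun k c => ?_⟩
  rw [← algebraMap_smul (RatFunc C)]
  by_cases hc : L.IsOrdinaryPoint c
  · refine IsIntegralAt.smul ?_ (expandAt_algebraMap_mem c _)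
    rw [isIntegralAt_cls]
    intro f hf
    rw [actAt_mono, map_one, one_mul]
    exact iterate_derivAt_mem_of_isOrdinaryPoint hL0 hc hf.2 k
  · obtain ⟨p, hp⟩ := algebraMap_prod_eq hfin.toFinset n (hfin.mem_toFinset.2 hc)
    rw [hp, mul_smul]
    exact (hn c _ le_rfl k).smul (expandAt_algebraMap_mem c p)

/-- Coefficients of globally integral classes have no poles at ordinary points and bounded ones
elsewhere. Clearing these leaves no finite pole, hence a polynomial. -/
theorem exists_smul_mem_span [IsAlgClosed C] {L : DiffOp C} (hL0 : L ≠ 0)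
    (hL : L.HasPuiseuxBases) :
    ∃ q : C[X], q ≠ 0 ∧ ∀ a : Fin L.order → RatFunc C, L.cls (ofCoeffs a) ∈ globallyIntegral L →
      ∀ k, ∃ p : C[X], algebraMap C[X] (RatFunc C) q * a k = algebraMap C[X] (RatFunc C) p := by
  choose n hn using fun c : C => exists_localParam_pow_mul_coeff_mem hL (c : OnePoint C)
  have hfin := finite_not_isOrdinaryPoint L
  refine ⟨∏ b ∈ hfin.toFinset, (X - Polynomial.C b) ^ n b,
    Finset.prod_ne_zero_iff.2 fun b _ => pow_ne_zero _ (X_sub_C_ne_zero b), fun a ha k => ?_⟩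
  refine exists_eq_algebraMap_of_forall_mem fun c => ?_
  by_cases hc : L.IsOrdinaryPoint c
  · rw [map_mul]
    exact mul_mem (expandAt_algebraMap_mem c _) ((isIntegralAt_ofCoeffs_iff hL0 hL hc a).1 (ha c) k)
  · obtain ⟨p, hp⟩ := algebraMap_prod_eq hfin.toFinset n (hfin.mem_toFinset.2 hc)
    rw [hp, mul_assoc, map_mul]
    exact mul_mem (expandAt_algebraMap_mem c p) (hn c _ le_rfl a (ha c) k)

theorem exists_zpow_smul_mem_integralAtInfinity {L : DiffOp C} (hL0 : L ≠ 0)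
    (hL : L.HasPuiseuxBases) (m : L.Quot) :
    ∃ n : ℤ, (RatFunc.X : RatFunc C) ^ n • m ∈ integralAtInfinity L := by
  obtain ⟨P, rfl⟩ := Submodule.Quotient.mk_surjective _ m
  obtain ⟨n, hn⟩ := exists_localParam_pow_smul_isIntegralAt hL0 hL OnePoint.infty fun _ : Unit => P
  refine ⟨-n, ?_⟩
  have h := hn n le_rfl ()
  rwa [localParam_infty, inv_pow, ← zpow_natCast, ← zpow_neg] at h

/-- A nonzero coefficient a_k has q a_k polynomial, so its order of vanishing at infinity is at most
deg q. Integrality of x^n m at infinity allows x^n a_k a pole of order at most s there, whence n ≤ s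
+ deg q. -/
theorem exists_bound_zpow_smul_mem [IsAlgClosed C] {L : DiffOp C} (hL0 : L ≠ 0)
    (hL : L.HasPuiseuxBases) :
    ∃ B : ℤ, ∀ m ∈ globallyIntegral L, m ≠ 0 → ∀ n : ℤ,
      (RatFunc.X : RatFunc C) ^ n • m ∈ integralAtInfinity L → n ≤ B := by
  obtain ⟨q, hq0, hq⟩ := exists_smul_mem_span hL0 hL
  obtain ⟨s, hs⟩ := exists_localParam_pow_mul_coeff_mem hL OnePoint.infty
  refine ⟨s + q.natDegree, fun m hm hm0 n hn => ?_⟩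
  obtain ⟨a, rfl⟩ := exists_cls_ofCoeffs_eq hL0 m
  have ha : ∃ k, a k ≠ 0 := by
    by_contra h
    push Not at h
    refine hm0 ?_
    rw [cls_ofCoeffs]
    exact Finset.sum_eq_zero fun k _ => by rw [h, zero_smul]
  obtain ⟨k, hk⟩ := ha
  obtain ⟨p, hp⟩ := hq a hm k
  have hq0' := RatFunc.algebraMap_ne_zero hq0
  have hp0 : p ≠ 0 := by
    rintro rfl
    rw [map_zero] at hp
    exact mul_ne_zero hq0' hk hp
  rw [smul_cls, smul_ofCoeffs] at hn
  have h1 := hs s le_rfl _ hn k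
  by_contra hlt
  obtain ⟨j, hj⟩ := Int.eq_ofNat_of_zero_le (a := n - s) (by omega)
  have h2 : localParam OnePoint.infty ^ s * ((RatFunc.X : RatFunc C) ^ n * a k) =
      RatFunc.X ^ j * a k := by
    rw [← mul_assoc, localParam_infty, inv_pow, ← zpow_natCast, ← zpow_neg,
      ← zpow_add₀ RatFunc.X_ne_zero, ← zpow_natCast, neg_add_eq_sub, hj]
  rw [h2] at h1
  have h3 : (RatFunc.X ^ j * a k) * algebraMap C[X] (RatFunc C) q =
      algebraMap C[X] (RatFunc C) (X ^ j * p) := by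
    rw [map_mul, ← hp, map_pow, RatFunc.algebraMap_X]
    ring
  have h4 := congrArg (fun g => (expandAt (OnePoint.infty : OnePoint C) g).order) h3
  rw [map_mul, HahnSeries.order_mul, order_expandAt_infty hq0, order_expandAt_infty,
    natDegree_mul (pow_ne_zero _ X_ne_zero) hp0, natDegree_X_pow] at h4
  · have h5 := HahnSeries.zero_le_orderTop_iff.1 h1
    have h6 : (j : ℚ) ≤ q.natDegree := by
      push_cast at h4
      linarith [(Nat.cast_nonneg p.natDegree : (0 : ℚ) ≤ _)]
    have h7 : j ≤ q.natDegree := by exact_mod_cast h6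
    omega
  · exact mul_ne_zero (pow_ne_zero _ X_ne_zero) hp0
  · exact (_root_.map_ne_zero _).2 (mul_ne_zero (pow_ne_zero _ RatFunc.X_ne_zero) hk)
  · exact (_root_.map_ne_zero _).2 hq0'

end DiffOp

/-! ### Lattice reduction at infinity -/

namespace DiffOp

variable {C : Type*} [Field C]

theorem inv_X_mem_ratAtInfinity : (RatFunc.X : RatFunc C)⁻¹ ∈ ratAtInfinity C :=
  ⟨1, X, X_ne_zero, by rw [degree_one, degree_X]; exact zero_le_one, by
    rw [map_one, RatFunc.algebraMap_X, one_div]⟩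

/-- The value at infinity of a rational function without a pole there. -/
theorem exists_eq_C_add_inv_X_mul {f : RatFunc C} (hf : f ∈ ratAtInfinity C) :
    ∃ c : C, ∃ b ∈ ratAtInfinity C,
      f = algebraMap C[X] (RatFunc C) (Polynomial.C c) + RatFunc.X⁻¹ * b := by
  obtain ⟨u, v, hv, huv, rfl⟩ := hf
  have hv' := RatFunc.algebraMap_ne_zero hv
  -- This is the value of u/v at infinity, zero when deg u < deg v. Subtracting it lowers the
  -- numerator's degree below that of v, leaving room for a factor x.
  set c := u.coeff v.natDegree / v.leadingCoeff with hc
  have hdeg : (X * (u - Polynomial.C c * v)).degree ≤ v.degree := by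
    rw [degree_eq_natDegree hv, degree_le_iff_coeff_zero]
    intro m hm
    have hm' : v.natDegree < m := by exact_mod_cast hm
    obtain ⟨m, rfl⟩ : ∃ m', m = m' + 1 := ⟨m - 1, by omega⟩
    rw [coeff_X_mul, coeff_sub, coeff_C_mul]
    rcases (Nat.lt_succ_iff.1 hm').eq_or_lt with h | h
    · rw [← h, hc, coeff_natDegree, div_mul_cancel₀ _ (Polynomial.leadingCoeff_ne_zero.2 hv), sub_self]
    · rw [coeff_eq_zero_of_natDegree_lt h,
        coeff_eq_zero_of_natDegree_lt ((natDegree_le_natDegree huv).trans_lt h), mul_zero, sub_zero]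
  refine ⟨c, _, ⟨_, v, hv, hdeg, rfl⟩, ?_⟩
  have hX : (RatFunc.X : RatFunc C) ≠ 0 := RatFunc.X_ne_zero
  rw [map_mul, map_sub, map_mul, RatFunc.algebraMap_X]
  field_simp
  ring

theorem exists_inv_X_pow_mul_mem {ι : Type*} [Finite ι] (a : ι → RatFunc C) :
    ∃ d : ℕ, ∀ i, (RatFunc.X : RatFunc C)⁻¹ ^ d * a i ∈ ratAtInfinity C := by
  have h : ∀ i, ∃ d : ℕ, (RatFunc.X : RatFunc C)⁻¹ ^ d * a i ∈ ratAtInfinity C := by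
    intro i
    refine ⟨(a i).num.natDegree, (a i).num, X ^ (a i).num.natDegree * (a i).denom,
      mul_ne_zero (pow_ne_zero _ X_ne_zero) (RatFunc.denom_ne_zero _), ?_, ?_⟩
    · rw [degree_mul, degree_X_pow]
      refine degree_le_natDegree.trans (le_add_of_nonneg_right ?_)
      exact zero_le_degree_iff.2 (RatFunc.denom_ne_zero _)
    · rw [map_mul, map_pow, RatFunc.algebraMap_X, mul_comm (RatFunc.X ^ _), ← div_div,
        RatFunc.num_div_denom, inv_pow, ← div_eq_inv_mul]
  choose d hd using h
  obtain ⟨N, hN⟩ := Finite.exists_le d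
  refine ⟨N, fun i => ?_⟩
  obtain ⟨e, he⟩ := Nat.exists_eq_add_of_le (hN i)
  rw [he, add_comm, pow_add, mul_assoc]
  exact mul_mem (pow_mem inv_X_mem_ratAtInfinity _) (hd i)

section Lattice

variable {V : Type*} [AddCommGroup V] [Module (RatFunc C) V]

theorem smul_mem_of_mem_ratAtInfinity {N : Submodule (ratAtInfinity C) V} {a : RatFunc C}
    (ha : a ∈ ratAtInfinity C) {v : V} (hv : v ∈ N) : a • v ∈ N :=
  N.smul_mem ⟨a, ha⟩ hv

/-- A family whose residues at infinity are independent generates the whole local lattice. -/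
theorem mem_ratAtInfinity_of_sum_smul_mem {ι : Type*} [Fintype ι]
    {N : Submodule (ratAtInfinity C) V} {v : ι → V} (hv : ∀ i, v i ∈ N)
    (hred : ∀ c : ι → C, (RatFunc.X : RatFunc C) •
      ∑ i, algebraMap C[X] (RatFunc C) (Polynomial.C (c i)) • v i ∈ N → c = 0)
    (a : ι → RatFunc C) (ha : ∑ i, a i • v i ∈ N) (i : ι) : a i ∈ ratAtInfinity C := by
  obtain ⟨d, hd⟩ := exists_inv_X_pow_mul_mem a
  induction d with
  | zero => simpa using hd i
  | succ d ih =>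
    apply ih
    -- Write x^(-d-1) a_i = c_i + x⁻¹ b_i. Multiplying by x shows x ∑ c_i v_i = x^(-d) ∑ a_i v_i - ∑
    -- b_i v_i ∈ N, so c = 0 and the pole bound drops from d + 1 to d.
    choose c b hb hcb using fun i => exists_eq_C_add_inv_X_mul (hd i)
    have hc : c = 0 := by
      apply hred
      have h1 : (RatFunc.X : RatFunc C) •
          ∑ i, algebraMap C[X] (RatFunc C) (Polynomial.C (c i)) • v i =
          (RatFunc.X : RatFunc C)⁻¹ ^ d • ∑ i, a i • v i - ∑ i, b i • v i := by
        rw [Finset.smul_sum, Finset.smul_sum, ← Finset.sum_sub_distrib]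
        refine Finset.sum_congr rfl fun i _ => ?_
        rw [smul_smul, smul_smul, ← sub_smul]
        congr 1
        have hX : (RatFunc.X : RatFunc C) ≠ 0 := RatFunc.X_ne_zero
        rw [← sub_eq_of_eq_add (hcb i), pow_succ]
        field_simp
      rw [h1]
      exact N.sub_mem (smul_mem_of_mem_ratAtInfinity (pow_mem inv_X_mem_ratAtInfinity _) ha)
        (N.sum_mem fun i _ => smul_mem_of_mem_ratAtInfinity (hb i) (hv i))
    intro i
    have h := hcb i
    rw [hc, Pi.zero_apply, map_zero, map_zero, zero_add, pow_succ', mul_assoc] at h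
    rw [mul_left_cancel₀ (inv_ne_zero RatFunc.X_ne_zero) h]
    exact hb i

theorem linearIndependent_ratAtInfinity {ι : Type*} {v : ι → V}
    (hv : LinearIndependent (RatFunc C) v) : LinearIndependent (ratAtInfinity C) v :=
  hv.restrict_scalars fun a b h => Subtype.ext (by simpa [Subring.smul_def] using h)

theorem linearIndependent_zpow_smul {ι : Type*} {w : ι → V} (hw : LinearIndependent (RatFunc C) w)
    (τ : ι → ℤ) : LinearIndependent (RatFunc C) fun i => (RatFunc.X : RatFunc C) ^ τ i • w i :=
  hw.units_smul fun i => Units.mk0 (RatFunc.X ^ τ i) (zpow_ne_zero _ RatFunc.X_ne_zero)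

variable [Module C[X] V] [IsScalarTower C[X] (RatFunc C) V]

/-- A lattice over `C[x]` is generated by `dim V` elements. -/
theorem exists_span_range_eq {ι : Type*} [Finite ι] {M : Submodule C[X] V} {b : ι → V}
    (hb : Submodule.span (RatFunc C) (Set.range b) = ⊤) {p : C[X]} (hp0 : p ≠ 0)
    (hp : ∀ i, p • b i ∈ M) {q : C[X]} (hq0 : q ≠ 0)
    (hq : ∀ m ∈ M, q • m ∈ Submodule.span C[X] (Set.range b)) :
    Submodule.span (RatFunc C) (M : Set V) = ⊤ ∧
      ∃ w : Fin (Module.finrank (RatFunc C) V) → V, Submodule.span C[X] (Set.range w) = M := by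
  have htop : Submodule.span (RatFunc C) (M : Set V) = ⊤ := by
    rw [eq_top_iff, ← hb, Submodule.span_le]
    rintro _ ⟨i, rfl⟩
    have h := Submodule.smul_mem (Submodule.span (RatFunc C) (M : Set V))
      (algebraMap C[X] (RatFunc C) p)⁻¹ (Submodule.subset_span (hp i))
    rwa [← algebraMap_smul (RatFunc C) p (b i), smul_smul,
      inv_mul_cancel₀ (RatFunc.algebraMap_ne_zero hp0), one_smul] at h
  have hreg : ∀ r : C[X], r ≠ 0 → ∀ v v' : V, r • v = r • v' → v = v' := by
    intro r hr v v' h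
    rw [← algebraMap_smul (RatFunc C) r v, ← algebraMap_smul (RatFunc C) r v'] at h
    exact smul_right_injective V (RatFunc.algebraMap_ne_zero hr) h
  have htf : Module.IsTorsionFree C[X] M :=
    ⟨fun r hr x y h => Subtype.ext (hreg r hr.ne_zero x y (congrArg Subtype.val h))⟩
  have hnoeth : IsNoetherian C[X] (Submodule.span C[X] (Set.range b)) :=
    isNoetherian_span_of_finite _ (Set.finite_range b)
  -- Multiplication by q embeds M into a finitely generated module, so M is Noetherian. Being
  -- torsion-free over a principal ideal domain, it is free.
  let φ : M →ₗ[C[X]] Submodule.span C[X] (Set.range b) :=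
    { toFun := fun m => ⟨q • (m : V), hq m m.2⟩
      map_add' := fun x y => Subtype.ext (smul_add q (x : V) y)
      map_smul' := fun r x => Subtype.ext (smul_comm q r (x : V)) }
  have hφ : Function.Injective φ := fun x y h =>
    Subtype.ext (hreg q hq0 x y (congrArg Subtype.val h))
  have : IsNoetherian C[X] M := isNoetherian_of_injective φ hφ
  let e := Module.finBasis C[X] M
  have hspan : Submodule.span C[X] (Set.range fun i => (e i : V)) = M := by
    have h := congrArg (Submodule.map M.subtype) e.span_eq
    rw [Submodule.map_span, ← Set.range_comp, Submodule.map_top, Submodule.range_subtype] at h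
    exact h
  have hli : LinearIndependent (RatFunc C) fun i => (e i : V) :=
    (LinearIndependent.iff_fractionRing C[X] (RatFunc C)).1
      (e.linearIndependent.map' M.subtype M.ker_subtype)
  have hle : ⊤ ≤ Submodule.span (RatFunc C) (Set.range fun i => (e i : V)) := by
    rw [← htop, Submodule.span_le]
    exact fun m hm => Submodule.span_subset_span C[X] (RatFunc C) _ (hspan.ge hm)
  -- A C[x]-basis of M is also a K-basis of V, so its length is dim V.
  have hcard := Module.finrank_eq_card_basis (Module.Basis.mk hli hle)
  rw [Fintype.card_fin] at hcard
  refine ⟨htop, fun i => e (Fin.cast hcard i), ?_⟩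
  refine Eq.trans (congrArg _ ?_) hspan
  exact (finCongr hcard).surjective.range_comp fun i => (e i : V)

/-- The exchange step of lattice reduction at infinity: a relation between the residues allows us
to increase one of the exponents. -/
theorem exists_exchange {d : ℕ} {N : Submodule (ratAtInfinity C) V} {w : Fin d → V}
    {τ : Fin d → ℤ} (hw : ∀ i, (RatFunc.X : RatFunc C) ^ τ i • w i ∈ N) {c : Fin d → C} (hc : c ≠ 0)
    (hcN : (RatFunc.X : RatFunc C) • ∑ i, algebraMap C[X] (RatFunc C) (Polynomial.C (c i)) •
      (RatFunc.X : RatFunc C) ^ τ i • w i ∈ N) :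
    ∃ (w' : Fin d → V) (τ' : Fin d → ℤ),
      Submodule.span C[X] (Set.range w') = Submodule.span C[X] (Set.range w) ∧
      (∀ i, (RatFunc.X : RatFunc C) ^ τ' i • w' i ∈ N) ∧ ∑ i, τ' i = ∑ i, τ i + 1 := by
  classical
  obtain ⟨i₁, hi₁⟩ := Function.ne_iff.1 hc
  obtain ⟨i₀, hi₀, hmin⟩ := Finset.exists_min_image (Finset.univ.filter fun i => c i ≠ 0) τ
    ⟨i₁, Finset.mem_filter.2 ⟨Finset.mem_univ _, hi₁⟩⟩
  have hci₀ : c i₀ ≠ 0 := (Finset.mem_filter.1 hi₀).2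
  -- Minimality of τ i₀ makes the exponents nonnegative wherever c i ≠ 0. Elsewhere the truncation
  -- by `toNat` is harmless because P i = 0.
  let P : Fin d → C[X] := fun i => Polynomial.C (c i) * X ^ (τ i - τ i₀).toNat
  set y : V := ∑ i, P i • w i with hy
  have hP : ∀ i, algebraMap C[X] (RatFunc C) (P i) = RatFunc.X ^ (-τ i₀) *
      (algebraMap C[X] (RatFunc C) (Polynomial.C (c i)) * RatFunc.X ^ τ i) := by
    intro i
    by_cases hci : c i = 0
    · simp [P, hci]
    · have h1 := hmin i (Finset.mem_filter.2 ⟨Finset.mem_univ _, hci⟩)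
      rw [map_mul, map_pow, RatFunc.algebraMap_X, ← zpow_natCast, Int.toNat_of_nonneg (by omega),
        mul_left_comm, ← zpow_add₀ RatFunc.X_ne_zero, neg_add_eq_sub]
  -- By construction x^(τ i₀) y is the dependent combination, so the relation gains one factor x.
  have hyN : (RatFunc.X : RatFunc C) ^ (τ i₀ + 1) • y ∈ N := by
    convert hcN using 1
    rw [hy, Finset.smul_sum, Finset.smul_sum]
    refine Finset.sum_congr rfl fun i _ => ?_
    rw [← algebraMap_smul (RatFunc C) (P i) (w i), hP, smul_smul, smul_smul, smul_smul]
    congr 1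
    rw [← mul_assoc, ← zpow_add₀ RatFunc.X_ne_zero, add_right_comm, add_neg_cancel, zero_add,
      zpow_one, mul_assoc]
  refine ⟨Function.update w i₀ y, Function.update τ i₀ (τ i₀ + 1), le_antisymm ?_ ?_, ?_, ?_⟩
  · rw [Submodule.span_le]
    rintro _ ⟨i, rfl⟩
    by_cases hi : i = i₀
    · subst hi
      rw [Function.update_self]
      exact Submodule.sum_mem _ fun j _ =>
        Submodule.smul_mem _ _ (Submodule.subset_span ⟨j, rfl⟩)
    · rw [Function.update_of_ne hi]
      exact Submodule.subset_span ⟨i, rfl⟩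
  · have hne : ∀ i, i ≠ i₀ → w i ∈ Submodule.span C[X] (Set.range (Function.update w i₀ y)) :=
      fun i hi => Submodule.subset_span ⟨i, Function.update_of_ne hi _ _⟩
    rw [Submodule.span_le]
    rintro _ ⟨i, rfl⟩
    by_cases hi : i = i₀
    · subst hi
      -- At the exchanged index P is the nonzero constant c i, a unit of C[x], so the replaced
      -- vector can be recovered.
      have h1 : w i = Polynomial.C (c i)⁻¹ • (y - ∑ j ∈ Finset.univ.erase i, P j • w j) := by
        rw [hy, ← Finset.add_sum_erase _ _ (Finset.mem_univ i), add_sub_cancel_right, smul_smul]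
        simp only [P]
        rw [sub_self, Int.toNat_zero, pow_zero, mul_one, ← map_mul, inv_mul_cancel₀ hci₀, map_one,
          one_smul]
      rw [SetLike.mem_coe, h1]
      refine Submodule.smul_mem _ _ (Submodule.sub_mem _ ?_ (Submodule.sum_mem _ fun j hj =>
        Submodule.smul_mem _ _ (hne j (Finset.ne_of_mem_erase hj))))
      exact Submodule.subset_span ⟨i, Function.update_self _ _ _⟩
    · exact hne i hi
  · intro i
    by_cases hi : i = i₀
    · subst hi
      rwa [Function.update_self, Function.update_self]
    · rw [Function.update_of_ne hi, Function.update_of_ne hi]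
      exact hw i
  · rw [Finset.sum_update_of_mem (Finset.mem_univ _), Finset.sdiff_singleton_eq_erase,
      ← Finset.add_sum_erase _ _ (Finset.mem_univ i₀)]
    ring

/-- A lattice over `C[x]` and a lattice over `C(x)_∞` have a common basis up to powers of `x`. -/
theorem exists_normal_basis {ι : Type*} [Finite ι] {M : Submodule C[X] V}
    {N : Submodule (ratAtInfinity C) V} {b : ι → V}
    (hb : Submodule.span (RatFunc C) (Set.range b) = ⊤) {p : C[X]} (hp0 : p ≠ 0)
    (hp : ∀ i, p • b i ∈ M) {q : C[X]} (hq0 : q ≠ 0)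
    (hq : ∀ m ∈ M, q • m ∈ Submodule.span C[X] (Set.range b))
    (hN : ∀ v : V, ∃ n : ℤ, (RatFunc.X : RatFunc C) ^ n • v ∈ N) {B : ℤ}
    (hB : ∀ m ∈ M, m ≠ 0 → ∀ n : ℤ, (RatFunc.X : RatFunc C) ^ n • m ∈ N → n ≤ B) :
    ∃ (d : ℕ) (w : Fin d → V) (τ : Fin d → ℤ), LinearIndependent C[X] w ∧
      Submodule.span C[X] (Set.range w) = M ∧
      LinearIndependent (ratAtInfinity C) (fun i => (RatFunc.X : RatFunc C) ^ τ i • w i) ∧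
      Submodule.span (ratAtInfinity C)
        (Set.range fun i => (RatFunc.X : RatFunc C) ^ τ i • w i) = N := by
  obtain ⟨htop, w₀, hw₀⟩ := exists_span_range_eq hb hp0 hp hq0 hq
  have hspanK : ∀ w : Fin (Module.finrank (RatFunc C) V) → V, Submodule.span C[X] (Set.range w) = M →
      ⊤ ≤ Submodule.span (RatFunc C) (Set.range w) := by
    intro w hw
    rw [← htop, Submodule.span_le, ← hw]
    exact Submodule.span_subset_span C[X] (RatFunc C) _
  have hli : ∀ w : Fin (Module.finrank (RatFunc C) V) → V, Submodule.span C[X] (Set.range w) = M →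
      LinearIndependent (RatFunc C) w := fun w hw =>
    linearIndependent_of_top_le_span_of_card_eq_finrank (hspanK w hw) (by rw [Fintype.card_fin])
  -- The exponent sums are bounded by dim V · B, since basis vectors are nonzero elements of M, and
  -- some admissible τ exists by `hN`.
  obtain ⟨s, ⟨w, τ, hw, hτ, hs⟩, hmax⟩ := Int.exists_greatest_of_bdd
    (P := fun s => ∃ (w : Fin (Module.finrank (RatFunc C) V) → V)
      (τ : Fin (Module.finrank (RatFunc C) V) → ℤ), Submodule.span C[X] (Set.range w) = M ∧
      (∀ i, (RatFunc.X : RatFunc C) ^ τ i • w i ∈ N) ∧ ∑ i, τ i = s)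
    (by
      refine ⟨∑ _i : Fin (Module.finrank (RatFunc C) V), B, ?_⟩
      rintro _ ⟨w, τ, hw, hτ, rfl⟩
      refine Finset.sum_le_sum fun i _ => hB (w i) ?_ ((hli w hw).ne_zero i) _ (hτ i)
      rw [← hw]
      exact Submodule.subset_span ⟨i, rfl⟩)
    (by
      choose τ hτ using fun i => hN (w₀ i)
      exact ⟨_, w₀, τ, hw₀, hτ, rfl⟩)
  have hred : ∀ c : Fin (Module.finrank (RatFunc C) V) → C, (RatFunc.X : RatFunc C) •
      ∑ i, algebraMap C[X] (RatFunc C) (Polynomial.C (c i)) •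
        (RatFunc.X : RatFunc C) ^ τ i • w i ∈ N → c = 0 := by
    intro c hcN
    by_contra hc
    obtain ⟨w', τ', h1, h2, h3⟩ := exists_exchange hτ hc hcN
    have := hmax _ ⟨w', τ', h1.trans hw, h2, h3⟩
    omega
  refine ⟨_, w, τ, (LinearIndependent.iff_fractionRing C[X] (RatFunc C)).2 (hli w hw), hw,
    linearIndependent_ratAtInfinity (linearIndependent_zpow_smul (hli w hw) τ), le_antisymm ?_ ?_⟩
  · rw [Submodule.span_le]
    rintro _ ⟨i, rfl⟩
    exact hτ i
  · intro n hn
    have hn' : n ∈ Submodule.span (RatFunc C) (Set.range w) := hspanK w hw trivial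
    obtain ⟨a, ha⟩ := (Submodule.mem_span_range_iff_exists_fun _).1 hn'
    have ha' : n = ∑ i, (a i * RatFunc.X ^ (-τ i)) • (RatFunc.X : RatFunc C) ^ τ i • w i := by
      rw [← ha]
      refine Finset.sum_congr rfl fun i _ => ?_
      rw [smul_smul, mul_assoc, ← zpow_add₀ RatFunc.X_ne_zero, neg_add_cancel, zpow_zero, mul_one]
    have hmem := mem_ratAtInfinity_of_sum_smul_mem hτ hred _ (ha' ▸ hn)
    rw [ha']
    exact Submodule.sum_mem _ fun i _ =>
      smul_mem_of_mem_ratAtInfinity (hmem i) (Submodule.subset_span ⟨i, rfl⟩)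

end Lattice

end DiffOp

/-! ### Existence of normal bases and correctness of the algorithm -/

namespace DiffOp

variable {C : Type*} [Field C]

theorem nonempty_normalIntegralBasis [IsAlgClosed C] [CharZero C] {L : DiffOp C} (hL0 : L ≠ 0)
    (hL : L.HasPuiseuxBases) : Nonempty (NormalIntegralBasis L) := by
  obtain ⟨p, hp0, hp⟩ := exists_smul_mem_globallyIntegral hL0 hL
  obtain ⟨q, hq0, hq⟩ := exists_smul_mem_span hL0 hL
  obtain ⟨B, hB⟩ := exists_bound_zpow_smul_mem hL0 hL
  obtain ⟨r, w, τ, hw, hwM, hv, hvN⟩ := exists_normal_basis (span_cls_mono_eq_top hL0) hp0 hp hq0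
    (fun m hm => by
      obtain ⟨a, rfl⟩ := exists_cls_ofCoeffs_eq hL0 m
      choose u hu using hq a hm
      rw [← algebraMap_smul (RatFunc C) q, smul_cls, smul_ofCoeffs, cls_ofCoeffs]
      refine Submodule.sum_mem _ fun k _ => ?_
      rw [hu, algebraMap_smul]
      exact Submodule.smul_mem _ _ (Submodule.subset_span ⟨k, rfl⟩))
    (exists_zpow_smul_mem_integralAtInfinity hL0 hL) hB
  exact ⟨⟨r, w, τ, ⟨hw, fun m => by rw [hwM, mem_globallyIntegral]⟩,
    ⟨hv, fun m => by rw [hvN, mem_integralAtInfinity]⟩⟩⟩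

theorem isCompletelyIntegral_iff {L : DiffOp C} {m : L.Quot} :
    IsCompletelyIntegral m ↔ IsGloballyIntegral m ∧ IsIntegralAt OnePoint.infty m :=
  ⟨fun h => ⟨fun c => h c, h _⟩, fun h ξ => by
    induction ξ using OnePoint.rec with
    | infty => exact h.2
    | coe c => exact h.1 c⟩

/-- The degree bound for a polynomial whose quotient by `x^τ` has no pole at infinity. -/
theorem natDegree_le_of_eq_mul_zpow {p : C[X]} (hp : p ≠ 0) {b : RatFunc C}
    (hb : b ∈ ratAtInfinity C) {τ : ℤ}
    (h : algebraMap C[X] (RatFunc C) p = b * RatFunc.X ^ τ) : (p.natDegree : ℤ) ≤ τ := by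
  by_contra hlt
  -- Clearing powers of x gives p x^k = b x^(deg p). Comparing orders at infinity yields k = -ord b
  -- ≤ 0, whereas k > 0 here.
  obtain ⟨k, hk⟩ := Int.eq_ofNat_of_zero_le (a := p.natDegree - τ) (by omega)
  have h1 : algebraMap C[X] (RatFunc C) (p * X ^ k) =
      b * algebraMap C[X] (RatFunc C) (X ^ p.natDegree) := by
    rw [map_mul, h, map_pow, map_pow, RatFunc.algebraMap_X, mul_assoc, ← zpow_natCast,
      ← zpow_add₀ RatFunc.X_ne_zero, ← zpow_natCast]
    congr 2
    omega
  have hpk : p * X ^ k ≠ 0 := mul_ne_zero hp (pow_ne_zero _ X_ne_zero)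
  have hXn : (X ^ p.natDegree : C[X]) ≠ 0 := pow_ne_zero _ X_ne_zero
  have hb0 : b ≠ 0 := by
    rintro rfl
    rw [zero_mul] at h1
    exact RatFunc.algebraMap_ne_zero hpk h1
  have h2 := congrArg (fun g => (expandAt (OnePoint.infty : OnePoint C) g).order) h1
  rw [order_expandAt_infty hpk, map_mul, HahnSeries.order_mul ((_root_.map_ne_zero _).2 hb0)
    ((_root_.map_ne_zero _).2 (RatFunc.algebraMap_ne_zero hXn)), order_expandAt_infty hXn,
    natDegree_mul hp (pow_ne_zero _ X_ne_zero), natDegree_X_pow, natDegree_X_pow] at h2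
  have h3 := HahnSeries.zero_le_orderTop_iff.1 (expandAt_infty_mem hb)
  have h4 : (k : ℚ) ≤ 0 := by
    push_cast at h2
    linarith
  have h5 : k ≤ 0 := by exact_mod_cast h4
  omega

theorem D_smul_C_smul {L : DiffOp C} (c : C) (m : L.Quot) :
    (D : DiffOp C) • algebraMap C[X] (RatFunc C) (Polynomial.C c) • m =
      algebraMap C[X] (RatFunc C) (Polynomial.C c) • ((D : DiffOp C) • m) := by
  have h : ratDeriv C (algebraMap C[X] (RatFunc C) (Polynomial.C c)) = 0 := by
    rw [← Polynomial.algebraMap_eq, ← IsScalarTower.algebraMap_apply, Derivation.map_algebraMap]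
  rw [D_smul_smul, h, zero_smul, zero_add]

namespace NormalIntegralBasis

variable {L : DiffOp C} (B : NormalIntegralBasis L)

theorem mem_pairs {i : Fin B.r} {j : ℕ} : (⟨i, j⟩ : (_ : Fin B.r) × ℕ) ∈ B.pairs ↔ (j : ℤ) ≤ B.τ i := by
  rw [pairs, Finset.mem_sigma, Finset.mem_range]
  simp only [Finset.mem_univ, true_and]
  omega

/-- Since x^j w_i = x^(-(τ_i - j)) · x^τ_i w_i, the bound j ≤ τ_i gives integrality at infinity, and
j ≥ 0 gives it at finite points. -/
theorem isCompletelyIntegral_elt {i : Fin B.r} {j : ℕ} (h : (j : ℤ) ≤ B.τ i) :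
    IsCompletelyIntegral (B.elt i j) := by
  refine isCompletelyIntegral_iff.2 ⟨(B.isIntegralBasis.2 _).1 ?_, (B.normal.2 _).1 ?_⟩
  · rw [elt, ← RatFunc.algebraMap_X, ← map_pow, algebraMap_smul]
    exact Submodule.smul_mem _ _ (Submodule.subset_span ⟨i, rfl⟩)
  · obtain ⟨k, hk⟩ := Int.eq_ofNat_of_zero_le (a := B.τ i - j) (by omega)
    have h1 : B.elt i j = (RatFunc.X : RatFunc C)⁻¹ ^ k • (RatFunc.X : RatFunc C) ^ B.τ i • B.w i := by
      rw [elt, smul_smul, inv_pow, ← zpow_natCast, ← zpow_natCast, ← zpow_neg,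
        ← zpow_add₀ RatFunc.X_ne_zero]
      congr 2
      omega
    rw [h1]
    exact smul_mem_of_mem_ratAtInfinity (pow_mem inv_X_mem_ratAtInfinity k)
      (Submodule.subset_span ⟨i, rfl⟩)

/-- The completely integral elements are the `C`-linear combinations of the `x^j w_i` with
`0 ≤ j ≤ τ_i`. -/
theorem exists_eq_sum_of_isCompletelyIntegral {m : L.Quot} (hm : IsCompletelyIntegral m) :
    ∃ p : Fin B.r → C[X], (∀ i, p i ≠ 0 → ((p i).natDegree : ℤ) ≤ B.τ i) ∧
      m = ∑ i, ∑ j ∈ Finset.range ((p i).natDegree + 1),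
        algebraMap C[X] (RatFunc C) (Polynomial.C ((p i).coeff j)) • B.elt i j := by
  obtain ⟨hfin, hinf⟩ := isCompletelyIntegral_iff.1 hm
  obtain ⟨p, hp⟩ := (Submodule.mem_span_range_iff_exists_fun _).1 ((B.isIntegralBasis.2 m).2 hfin)
  obtain ⟨b, hb⟩ := (Submodule.mem_span_range_iff_exists_fun _).1 ((B.normal.2 m).2 hinf)
  have hli : LinearIndependent (RatFunc C) B.w :=
    (LinearIndependent.iff_fractionRing C[X] (RatFunc C)).1 B.isIntegralBasis.1
  -- Independence over C[x] lifts to the fraction field K, where the two expansions of m must agree.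
  have hpb : ∀ i, algebraMap C[X] (RatFunc C) (p i) = (b i : RatFunc C) * RatFunc.X ^ B.τ i := by
    refine fun i => sub_eq_zero.1 (Fintype.linearIndependent_iff.1 hli
      (fun i => algebraMap C[X] (RatFunc C) (p i) - (b i : RatFunc C) * RatFunc.X ^ B.τ i) ?_ i)
    simp only [sub_smul, Finset.sum_sub_distrib, mul_smul, algebraMap_smul]
    rw [hp, sub_eq_zero, ← hb]
    rfl
  refine ⟨p, fun i hi => natDegree_le_of_eq_mul_zpow hi (b i).2 (hpb i), ?_⟩
  rw [← hp]
  refine Finset.sum_congr rfl fun i _ => ?_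
  rw [← algebraMap_smul (RatFunc C) (p i)]
  conv_lhs => rw [(p i).as_sum_range_C_mul_X_pow, map_sum, Finset.sum_smul]
  refine Finset.sum_congr rfl fun j _ => ?_
  rw [map_mul, map_pow, RatFunc.algebraMap_X, mul_smul, elt]

theorem isConstant_of_forall_pairs (h : ∀ p ∈ B.pairs, (D : DiffOp C) • B.elt p.1 p.2 = 0)
    {m : L.Quot} (hm : IsCompletelyIntegral m) : IsConstant m := by
  obtain ⟨p, hp, rfl⟩ := B.exists_eq_sum_of_isCompletelyIntegral hm
  rw [IsConstant, Finset.smul_sum]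
  refine Finset.sum_eq_zero fun i _ => ?_
  rw [Finset.smul_sum]
  refine Finset.sum_eq_zero fun j hj => ?_
  rw [D_smul_C_smul]
  -- When p i = 0 the range still contains j = 0, although τ i may be negative and (i, 0) untested.
  -- The term vanishes because its coefficient does.
  by_cases hpi : p i = 0
  · rw [hpi, coeff_zero, map_zero, map_zero, zero_smul]
  · have hj' := Finset.mem_range.1 hj
    have h1 := hp i hpi
    rw [h ⟨i, j⟩ (B.mem_pairs.2 (by omega)), smul_zero]

theorem isPseudoconstant_of_mem_pairs {p : (_ : Fin B.r) × ℕ} (hp : p ∈ B.pairs)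
    (hne : (D : DiffOp C) • B.elt p.1 p.2 ≠ 0) : IsPseudoconstant (B.elt p.1 p.2) :=
  ⟨B.isCompletelyIntegral_elt (B.mem_pairs.1 hp), hne⟩

theorem exists_returns : ∃ out : Option L.Quot, B.Returns out := by
  by_cases h : ∀ p ∈ B.pairs, (D : DiffOp C) • B.elt p.1 p.2 = 0
  · exact ⟨none, .bot h⟩
  · push Not at h
    obtain ⟨p, hp, hne⟩ := h
    exact ⟨_, .found p hp hne⟩

end NormalIntegralBasis

end DiffOp

end

theorem mainTheorem6 {C : Type*} [Field C] [IsAlgClosed C] [CharZero C]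
    (L : DiffOp C) (hL0 : L ≠ 0) (hL : L.HasPuiseuxBases) :
    -- the first step can be carried out
    Nonempty (DiffOp.NormalIntegralBasis L) ∧
    -- whatever the first step produces, the algorithm terminates with some output ...
    ∀ B : DiffOp.NormalIntegralBasis L,
      (∃ out : Option L.Quot, B.Returns out) ∧
      -- ... and every possible output is correct
      ∀ out : Option L.Quot, B.Returns out →
        ((∃ m : L.Quot, DiffOp.IsPseudoconstant m) →
          ∃ m : L.Quot, out = some m ∧ DiffOp.IsPseudoconstant m) ∧
        ((¬ ∃ m : L.Quot, DiffOp.IsPseudoconstant m) → out = none) := by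
  refine ⟨DiffOp.nonempty_normalIntegralBasis hL0 hL, fun B => ⟨B.exists_returns, ?_⟩⟩
  rintro _ (⟨p, hp, hne⟩ | h)
  · have hm := B.isPseudoconstant_of_mem_pairs hp hne
    exact ⟨fun _ => ⟨_, rfl, hm⟩, fun h => absurd ⟨_, hm⟩ h⟩
  · refine ⟨?_, fun _ => rfl⟩
    rintro ⟨m, hm, hne⟩
    exact absurd (B.isConstant_of_forall_pairs h hm) hne
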